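/- **Online Stochastic Matching with Timeouts.** An instance consists of a finite set $A$ of items, a finite set $B$ of buyer types, for each pair $ab\in A\times B$ a rational existence probability $p_{ab}\in(0,1]$ and a rational profit $w_{ab}>0$, for each $b\in B$ a timeout $t_b\in\{1,2,\dots\}$, and multiplicities $k_b\in\{0,1,2,\dots\}$; put $n=\sum_b k_b$. There are $n$ rounds. In each round a buyer arrives whose type is drawn independently of everything else, type $b$ having probability $k_b/n$. The online algorithm, which knows the instance and the past but not the future, then chooses at most $t_b$ distinct, still unmatched items and probes the corresponding edges one after another; each probed edge $ab$ is present with probability $p_{ab}$, independently of everything else. Probing stops at the first present edge $ab$: the buyer is irrevocably matched to $a$ and the profit $w_{ab}$ is gained. If all chosen edges are absent, the buyer remains unmatched. Let $OPT$ be the maximum expected total profit of an online algorithm (with unlimited computational power). Split each type $b$ into $k_b$ copies having the data of $b$, let $B'$ be the set of the resulting $n$ copies (each sampled with probability $1/n$), and let $LP_{onl}$ be the optimal value of the linear program $$\max \sum_{a\in A,\,b\in B'} w_{ab}p_{ab}x_{ab}$$ subject to $\sum_{b\in B'}p_{ab}x_{ab}\le 1$ for all $a\in A$; $\sum_{a\in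 A}p_{ab}x_{ab}\le 1$ and $\sum_{a\in A}x_{ab}\le t_b$ for all $b\in B'$; and $0\le x_{ab}\le 1$ for all $a\in A$, $b\in B'$. **Theorem.** There is a randomized polynomial-time online algorithm for Online Stochastic Matching with Timeouts whose expected profit on every instance is at least $LP_{onl}/4.07$ and at least $OPT/4.07$. Here polynomial time means polynomial in $n$ plus the bit length of the instance, both for the number of independent fair random bits used and for the time needed for each of the $n$ decisions on a random access machine with logarithmic cost. -/

import Mathlib

/-! ### Online Stochastic Matching with Timeouts: instances -/

/-- An instance: a complete bipartite graph between `items` items and `types` buyer types.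
The edge `ab` has existence probability `prob a b ∈ (0,1]` and profit `profit a b > 0`, the buyer
type `b` has the positive timeout `timeout b`, and items have no timeout.
There are `n = ∑ b, mult b` rounds, and in each of them a buyer of random type arrives, which is
`b` with probability `mult b / n` (so all probabilities are integer multiples of `1 / n`). -/
structure Instance where
  items : ℕ
  types : ℕ
  mult : Fin types → ℕ
  timeout : Fin types → ℕ
  prob : Fin items → Fin types → ℚ
  profit : Fin items → Fin types → ℚ
  timeout_pos : ∀ b, 0 < timeout b
  prob_pos : ∀ a b, 0 < prob a b
  prob_le_one : ∀ a b, prob a b ≤ 1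
  profit_pos : ∀ a b, 0 < profit a b

namespace Instance

/-- The number `n` of rounds. -/
def rounds (I : Instance) : ℕ := ∑ b, I.mult b

/-! ### The linear program -/

/-- Feasibility for the linear program. Every buyer type `b` is split into `mult b` copies, each of
which is sampled with probability `1 / n`; `x a b j` belongs to item `a` and the `j`-th copy
of type `b`. -/
structure LPFeasible (I : Instance) (x : Fin I.items → (b : Fin I.types) → Fin (I.mult b) → ℝ) :
    Prop where
  item_le : ∀ a, ∑ b, ∑ j, (I.prob a b : ℝ) * x a b j ≤ 1
  buyer_le : ∀ b j, ∑ a, (I.prob a b : ℝ) * x a b j ≤ 1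
  timeout_le : ∀ b j, ∑ a, x a b j ≤ (I.timeout b : ℝ)
  nonneg : ∀ a b j, 0 ≤ x a b j
  le_one : ∀ a b j, x a b j ≤ 1

/-- The objective function of the linear program. -/
noncomputable def lpValue (I : Instance)
    (x : Fin I.items → (b : Fin I.types) → Fin (I.mult b) → ℝ) : ℝ :=
  ∑ a, ∑ b, ∑ j, (I.profit a b : ℝ) * (I.prob a b : ℝ) * x a b j

/-- The optimal value of the linear program. -/
noncomputable def lpOnl (I : Instance) : ℝ := sSup {v | ∃ x, I.LPFeasible x ∧ v = I.lpValue x}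

/-! ### Online policies and their expected profit -/

/-- What has been observed in the rounds so far, most recent round first: the type of the buyer
and the item she was matched to, if any. -/
abbrev History (I : Instance) : Type := List (Fin I.types × Option (Fin I.items))

/-- A deterministic online policy: given the past and the type of the buyer who has just arrived,
the list of items that are offered to her, in the order in which the edges are probed (until one
of them turns out to be present). A policy knows its own earlier choices, since they are a function
of the past. -/
abbrev Policy (I : Instance) : Type := I.History → Fin I.types → List (Fin I.items)

/-- The policy offers, in every round, at most `timeout b` distinct items, all of them still
unmatched. -/
def Policy.Feasible {I : Instance} (π : I.Policy) : Prop :=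
  ∀ (h : I.History) (b : Fin I.types), h.length < I.rounds →
    (π h b).Nodup ∧ (π h b).length ≤ I.timeout b ∧ ∀ a ∈ π h b, ∀ r ∈ h, r.2 ≠ some a

/-- Expected profit from probing the edges from `b` to the items of a list one after another until
one is present, followed by a continuation whose expected profit is `V m` if `m` is the item
to which `b` has been matched (if any). -/
noncomputable def probeValue (I : Instance) (b : Fin I.types)
    (V : Option (Fin I.items) → ℝ) : List (Fin I.items) → ℝ
  | [] => V none
  | a :: l =>
      (I.prob a b : ℝ) * ((I.profit a b : ℝ) + V (some a)) +
        (1 - (I.prob a b : ℝ)) * probeValue I b V l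

/-- Expected profit of a policy in the next `k` rounds, given the past `h`. -/
noncomputable def Policy.valueFrom {I : Instance} (π : I.Policy) : ℕ → I.History → ℝ
  | 0, _ => 0
  | k + 1, h =>
      ∑ b, ((I.mult b : ℝ) / (I.rounds : ℝ)) *
        I.probeValue b (fun m => Policy.valueFrom π k ((b, m) :: h)) (π h b)

/-- Expected total profit of a policy. -/
noncomputable def Policy.expectedProfit {I : Instance} (π : I.Policy) : ℝ :=
  π.valueFrom I.rounds []

/-- The expected profit of an optimal online policy. A randomized policy is a mixture of
deterministic ones and so cannot exceed this value. -/
noncomputable def opt (I : Instance) : ℝ :=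
  sSup {v | ∃ π : I.Policy, π.Feasible ∧ v = π.expectedProfit}

/-! The two suprema above are over non-empty bounded sets. -/

theorem lpValues_nonempty (I : Instance) :
    {v | ∃ x, I.LPFeasible x ∧ v = I.lpValue x}.Nonempty :=
  ⟨_, fun _ _ _ => 0, ⟨by simp, by simp, by simp, by simp, by simp⟩, rfl⟩

theorem lpValues_bddAbove (I : Instance) :
    BddAbove {v | ∃ x, I.LPFeasible x ∧ v = I.lpValue x} := by
  refine ⟨∑ a, ∑ b, ∑ _j : Fin (I.mult b), (I.profit a b : ℝ) * (I.prob a b : ℝ), ?_⟩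
  rintro v ⟨x, hx, rfl⟩
  refine Finset.sum_le_sum fun a _ => Finset.sum_le_sum fun b _ => Finset.sum_le_sum fun j _ => ?_
  have h1 : (0 : ℝ) ≤ (I.profit a b : ℝ) := by exact_mod_cast (I.profit_pos a b).le
  have h2 : (0 : ℝ) ≤ (I.prob a b : ℝ) := by exact_mod_cast (I.prob_pos a b).le
  exact mul_le_of_le_one_right (mul_nonneg h1 h2) (hx.le_one a b j)

theorem optValues_nonempty (I : Instance) :
    {v | ∃ π : I.Policy, π.Feasible ∧ v = π.expectedProfit}.Nonempty :=
  ⟨_, fun _ _ => [], fun _ _ _ => by simp, rfl⟩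

theorem probeValue_le (I : Instance) (b : Fin I.types) (V : Option (Fin I.items) → ℝ) (C W : ℝ)
    (hW0 : 0 ≤ W) (hW : ∀ a, (I.profit a b : ℝ) ≤ W) (hV : ∀ m, V m ≤ C)
    (l : List (Fin I.items)) : I.probeValue b V l ≤ W + C := by
  induction l with
  | nil => simp only [probeValue]; linarith [hV none]
  | cons a l ih =>
    have h2 : (0 : ℝ) ≤ (I.prob a b : ℝ) := by exact_mod_cast (I.prob_pos a b).le
    have h3 : (I.prob a b : ℝ) ≤ 1 := by exact_mod_cast I.prob_le_one a b
    have h4 := mul_le_mul_of_nonneg_left (add_le_add (hW a) (hV (some a))) h2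
    have h5 := mul_le_mul_of_nonneg_left ih (sub_nonneg.2 h3)
    simp only [probeValue]
    linarith

theorem optValues_bddAbove (I : Instance) :
    BddAbove {v | ∃ π : I.Policy, π.Feasible ∧ v = π.expectedProfit} := by
  obtain ⟨W, hW0, hW⟩ : ∃ W : ℝ, 0 ≤ W ∧ ∀ a b, (I.profit a b : ℝ) ≤ W := by
    have h0 : ∀ a b, (0 : ℝ) ≤ (I.profit a b : ℝ) := fun a b => by
      exact_mod_cast (I.profit_pos a b).le
    refine ⟨∑ a, ∑ b, (I.profit a b : ℝ),
      Finset.sum_nonneg fun a _ => Finset.sum_nonneg fun b _ => h0 a b, fun a b => ?_⟩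
    exact (Finset.single_le_sum (f := fun b => (I.profit a b : ℝ)) (fun b _ => h0 a b)
      (Finset.mem_univ b)).trans (Finset.single_le_sum (f := fun a => ∑ b, (I.profit a b : ℝ))
        (fun a _ => Finset.sum_nonneg fun b _ => h0 a b) (Finset.mem_univ a))
  have hq : ∑ b, ((I.mult b : ℝ) / (I.rounds : ℝ)) ≤ 1 := by
    rw [← Finset.sum_div, ← Nat.cast_sum]
    exact div_self_le_one _
  refine ⟨I.rounds * W, ?_⟩
  rintro v ⟨π, -, rfl⟩
  have key : ∀ (k : ℕ) (h : I.History), π.valueFrom k h ≤ k * W := by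
    intro k
    induction k with
    | zero => intro h; simp [Policy.valueFrom]
    | succ k ih =>
      intro h
      have hnn : 0 ≤ W + k * W := by positivity
      simp only [Policy.valueFrom]
      calc _ ≤ ∑ b, ((I.mult b : ℝ) / (I.rounds : ℝ)) * (W + k * W) :=
            Finset.sum_le_sum fun b _ => mul_le_mul_of_nonneg_left
              (I.probeValue_le b _ _ W hW0 (fun a => hW a b) (fun m => ih _) _) (by positivity)
        _ ≤ 1 * (W + k * W) := by
            rw [← Finset.sum_mul]; exact mul_le_mul_of_nonneg_right hq hnn
        _ = _ := by push_cast; ring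
  exact key _ _

end Instance

/-! ### The machine model: a random access machine with logarithmic cost -/

/-- The memory: `s x i` is the natural number in entry `i` of array number `x`. A program mentions
finitely many arrays. -/
abbrev Store : Type := ℕ → ℕ → ℕ

/-- Arithmetic expressions; `cell x i` is entry `i` of array `x`. -/
inductive Expr : Type where
  | const (c : ℕ)
  | cell (x : ℕ) (i : Expr)
  | add (e f : Expr)
  | sub (e f : Expr)
  | mul (e f : Expr)
  | div (e f : Expr)

namespace Expr

/-- The value of an expression (subtraction is truncated, division rounds down). -/
def val (s : Store) : Expr → ℕ
  | const c => c
  | cell x i => s x (i.val s)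
  | add e f => e.val s + f.val s
  | sub e f => e.val s - f.val s
  | mul e f => e.val s * f.val s
  | div e f => e.val s / f.val s

/-- The cost of evaluating an expression: every operation is charged one unit plus the number of
bits of its operands, and a memory access is charged for the address and for the content. -/
def cost (s : Store) : Expr → ℕ
  | const c => 1 + c.size
  | cell x i => i.cost s + 1 + (i.val s).size + (s x (i.val s)).size
  | add e f => e.cost s + f.cost s + 1 + (e.val s).size + (f.val s).size
  | sub e f => e.cost s + f.cost s + 1 + (e.val s).size + (f.val s).size
  | mul e f => e.cost s + f.cost s + 1 + (e.val s).size + (f.val s).size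
  | div e f => e.cost s + f.cost s + 1 + (e.val s).size + (f.val s).size

end Expr

/-- Programs; `assign x i e` stores the value of `e` in entry `i` of array `x`, and a condition
holds if its value is not zero. -/
inductive Prog : Type where
  | skip
  | assign (x : ℕ) (i e : Expr)
  | seq (c d : Prog)
  | cond (e : Expr) (c d : Prog)
  | loop (e : Expr) (c : Prog)

/-- `Exec c s s' t`: started in memory `s`, the program `c` halts in memory `s'` with total
cost `t`. -/
inductive Exec : Prog → Store → Store → ℕ → Prop where
  | skip (s : Store) : Exec Prog.skip s s 1
  | assign (x : ℕ) (i e : Expr) (s : Store) :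
      Exec (Prog.assign x i e) s
        (Function.update s x (Function.update (s x) (i.val s) (e.val s)))
        (i.cost s + e.cost s + 1 + (i.val s).size + (e.val s).size)
  | seq {c d : Prog} {s s' s'' : Store} {t t' : ℕ} (h : Exec c s s' t) (h' : Exec d s' s'' t') :
      Exec (Prog.seq c d) s s'' (t + t')
  | cond_true {e : Expr} {c d : Prog} {s s' : Store} {t : ℕ} (he : e.val s ≠ 0)
      (h : Exec c s s' t) : Exec (Prog.cond e c d) s s' (e.cost s + 1 + t)
  | cond_false {e : Expr} {c d : Prog} {s s' : Store} {t : ℕ} (he : e.val s = 0)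
      (h : Exec d s s' t) : Exec (Prog.cond e c d) s s' (e.cost s + 1 + t)
  | loop_true {e : Expr} {c : Prog} {s s' s'' : Store} {t t' : ℕ} (he : e.val s ≠ 0)
      (h : Exec c s s' t) (h' : Exec (Prog.loop e c) s' s'' t') :
      Exec (Prog.loop e c) s s'' (e.cost s + 1 + t + t')
  | loop_false {e : Expr} {c : Prog} {s : Store} (he : e.val s = 0) :
      Exec (Prog.loop e c) s s (e.cost s + 1)

/-- The initial memory: the `x`-th list of the input is in array `x`, all else is zero. -/
def Store.init (input : List (List ℕ)) : Store := fun x i => (input.getD x []).getD i 0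

/-- Given the input, the program halts with cost at most `T` and outputs the given list: its
length is then in entry `0` of array `0`, and its members are in array `1`. -/
def RunsWithin (c : Prog) (input : List (List ℕ)) (T : ℕ) (output : List ℕ) : Prop :=
  ∃ (s : Store) (t : ℕ), Exec c (Store.init input) s t ∧ t ≤ T ∧
    s 0 0 = output.length ∧ ∀ i, (hi : i < output.length) → s 1 i = output[i]

/-! ### Polynomial-time randomized online algorithms -/

namespace Instance

/-- A matrix of rational or other data as a list, row by row. -/
def rows (I : Instance) (f : Fin I.items → Fin I.types → ℕ) : List ℕ :=
  (List.finRange I.items).flatMap fun a => (List.finRange I.types).map fun b => f a b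

/-- The description of an instance by lists of natural numbers. -/
def encode (I : Instance) : List (List ℕ) :=
  [ [I.items, I.types, I.rounds],
    List.ofFn I.mult,
    List.ofFn I.timeout,
    I.rows fun a b => (I.prob a b).num.toNat,
    I.rows fun a b => (I.prob a b).den,
    I.rows fun a b => (I.profit a b).num.toNat,
    I.rows fun a b => (I.profit a b).den ]

/-- The size of an instance: the number of rounds plus the length in bits of its description
(with one separator for each number). -/
def size (I : Instance) : ℕ :=
  I.rounds + (I.encode.map fun l => (l.map fun k => k.size + 1).sum).sum

/-- The input for one decision: the instance, the random bits, the observed past (`0` stands for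
an unmatched buyer and `a + 1` for a buyer matched to item `a`), and the type of the buyer who has
just arrived. -/
def decisionInput (I : Instance) {m : ℕ} (coins : Fin m → Bool) (h : I.History)
    (b : Fin I.types) : List (List ℕ) :=
  I.encode ++
    [ [m, h.length, b.val],
      List.ofFn fun i => (coins i).toNat,
      h.map fun r => r.1.val,
      h.map fun r => r.2.elim 0 fun a => a.val + 1 ]

end Instance

/-- A randomized polynomial-time online algorithm: one program that, on every instance, uses
a polynomial number of independent fair random bits, drawn in advance, and computes in
polynomial time, in each round, what to offer to the buyer who has just arrived. -/
structure PolyTimeOnlineAlgorithm where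
  program : Prog
  coins : Polynomial ℕ
  time : Polynomial ℕ
  /-- The deterministic policy followed for given values of the random bits. -/
  policy : (I : Instance) → (Fin (coins.eval I.size) → Bool) → I.Policy
  feasible : ∀ I r, (policy I r).Feasible
  computes : ∀ (I : Instance) (r : Fin (coins.eval I.size) → Bool) (h : I.History)
    (b : Fin I.types), h.length < I.rounds →
      RunsWithin program (I.decisionInput r h b) (time.eval I.size)
        ((policy I r h b).map fun a => a.val)

/-- The expected profit of a randomized online algorithm, over its random bits, the arrivals of the
buyers and the presence of the edges. -/
noncomputable def PolyTimeOnlineAlgorithm.expectedProfit (𝒜 : PolyTimeOnlineAlgorithm)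
    (I : Instance) : ℝ :=
  (∑ r : Fin (𝒜.coins.eval I.size) → Bool, (𝒜.policy I r).expectedProfit) /
    2 ^ (𝒜.coins.eval I.size)

/-! The algorithm is deterministic: approximate dynamic programming, backward in time, with a value
function that is linear in the set of available items. Each available item contributes its `price`,
which also serves as its opportunity cost `v`. Probing `a` before a list of expected net profit `G`
changes this profit by `surplus`, that is, by p(w - v - G). The greedy list is built by repeatedly
putting the item of largest positive surplus in front, while the timeout permits. Its value is at
least half of the optimum of the one-buyer linear program with the same costs
(`sum_le_two_mul_greedyValue`). Each price then grows by the expected net profit that the list draws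
from its item, so during one round the total price grows by the expected greedy value
(`sum_price_round`).

Let P be the sum of the start prices. Offering the available part of the greedy list earns at least
the total price of the available items (`le_valueFrom_pricePolicy`): deleting matched items only
makes the others more likely to be reached, and no item of the list has negative net profit. Hence
the policy earns at least P.

For the upper bound, the start prices act as dual variables of the item constraints and contribute
at most P. Prices only grow with the number of remaining rounds, so the net profit of a buyer over
the start prices is at most twice the greedy value of her type in every single round, hence at most
the average of these bounds, `buyerBound`. Summed over all buyers, the averages telescope to 2P
(`sum_buyerBound`). Thus the linear program is at most 3P (`lpValue_le`). The same prices, used as a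
potential function, bound every online policy by 3P (`valueFrom_le`), and 3 < 4.07.

For polynomial time, the prices are recomputed exactly, as fractions, at every decision. A price
enters its own update linearly, with a matching probability that is built from input data only, so
each update adds a polynomial number of bits instead of multiplying their number. `Prog.Runs` is a
Hoare-style judgement that carries time, entry size and a frame condition; `runs_main` applies it to
the whole program. -/

namespace Instance

/-! ### Probing a list of items -/

/-- The probability that the edge from `b` to `a` is probed when the items of a list are offered. -/
noncomputable def reachProb (I : Instance) (b : Fin I.types) :
    List (Fin I.items) → Fin I.items → ℝ
  | [], _ => 0
  | c :: l, a => (if a = c then 1 else 0) + (1 - (I.prob c b : ℝ)) * reachProb I b l a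

/-- The probability that all edges from `b` to the items of a list are absent. -/
noncomputable def missProb (I : Instance) (b : Fin I.types) (l : List (Fin I.items)) : ℝ :=
  (l.map fun c => 1 - (I.prob c b : ℝ)).prod

theorem prob_real_nonneg (I : Instance) (a : Fin I.items) (b : Fin I.types) :
    (0 : ℝ) ≤ I.prob a b := by exact_mod_cast (I.prob_pos a b).le

theorem one_sub_prob_nonneg (I : Instance) (a : Fin I.items) (b : Fin I.types) :
    (0 : ℝ) ≤ 1 - I.prob a b := sub_nonneg.2 (by exact_mod_cast I.prob_le_one a b)

theorem reachProb_nonneg (I : Instance) (b : Fin I.types) (l : List (Fin I.items))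
    (a : Fin I.items) : 0 ≤ I.reachProb b l a := by
  induction l with
  | nil => simp [reachProb]
  | cons c l ih =>
    have := mul_nonneg (I.one_sub_prob_nonneg c b) ih
    simp only [reachProb]
    split_ifs <;> linarith

theorem reachProb_eq_zero (I : Instance) (b : Fin I.types) {l : List (Fin I.items)}
    {a : Fin I.items} (h : a ∉ l) : I.reachProb b l a = 0 := by
  induction l with
  | nil => simp [reachProb]
  | cons c l ih =>
    simp only [List.mem_cons, not_or] at h
    simp [reachProb, h.1, ih h.2]

theorem reachProb_le_one (I : Instance) (b : Fin I.types) {l : List (Fin I.items)}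
    (hl : l.Nodup) (a : Fin I.items) : I.reachProb b l a ≤ 1 := by
  induction l with
  | nil => simp [reachProb]
  | cons c l ih =>
    rw [List.nodup_cons] at hl
    simp only [reachProb]
    split_ifs with h
    · subst h; simp [I.reachProb_eq_zero b hl.1]
    · have h1 := mul_le_mul_of_nonneg_left (ih hl.2) (I.one_sub_prob_nonneg c b)
      have := I.prob_real_nonneg c b
      linarith

theorem sum_reachProb_le_length (I : Instance) (b : Fin I.types) (l : List (Fin I.items)) :
    ∑ a, I.reachProb b l a ≤ l.length := by
  induction l with
  | nil => simp [reachProb]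
  | cons c l ih =>
    simp only [reachProb, Finset.sum_add_distrib, ← Finset.mul_sum, Finset.sum_ite_eq',
      Finset.mem_univ, if_true, List.length_cons]
    have h0 : 0 ≤ ∑ a, I.reachProb b l a :=
      Finset.sum_nonneg fun a _ => I.reachProb_nonneg b l a
    have := mul_nonneg (I.prob_real_nonneg c b) h0
    push_cast
    linarith

/-- Either some probed edge is the one that ends probing, or all edges are absent. Hence reach
probabilities satisfy the buyer constraint of the linear program. -/
theorem sum_prob_mul_reachProb (I : Instance) (b : Fin I.types) (l : List (Fin I.items)) :
    ∑ a, (I.prob a b : ℝ) * I.reachProb b l a = 1 - I.missProb b l := by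
  induction l with
  | nil => simp [reachProb, missProb]
  | cons c l ih =>
    have : ∀ a, (I.prob a b : ℝ) * I.reachProb b (c :: l) a =
        (if a = c then (I.prob a b : ℝ) else 0) +
          (1 - I.prob c b) * ((I.prob a b : ℝ) * I.reachProb b l a) := by
      intro a; simp only [reachProb]; split_ifs <;> ring
    simp only [this, Finset.sum_add_distrib, ← Finset.mul_sum, ih, Finset.sum_ite_eq',
      Finset.mem_univ, if_true, missProb, List.map_cons, List.prod_cons]
    ring

theorem missProb_nonneg (I : Instance) (b : Fin I.types) (l : List (Fin I.items)) :
    0 ≤ I.missProb b l := by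
  refine List.prod_nonneg fun x hx => ?_
  obtain ⟨c, -, rfl⟩ := List.mem_map.1 hx
  exact I.one_sub_prob_nonneg c b

theorem missProb_append_singleton (I : Instance) (b : Fin I.types) (l : List (Fin I.items))
    (c : Fin I.items) : I.missProb b (l ++ [c]) = I.missProb b l * (1 - I.prob c b) := by
  simp [missProb]

theorem reachProb_append_singleton (I : Instance) (b : Fin I.types) (l : List (Fin I.items))
    (c a : Fin I.items) :
    I.reachProb b (l ++ [c]) a = I.reachProb b l a + if a = c then I.missProb b l else 0 := by
  induction l with
  | nil => simp [reachProb, missProb]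
  | cons d l ih =>
    simp only [List.cons_append, reachProb, ih, missProb, List.map_cons, List.prod_cons]
    split_ifs <;> ring

/-- Deleting other items only removes occasions to stop before `a`. -/
theorem reachProb_le_filter (I : Instance) (b : Fin I.types) (l : List (Fin I.items))
    (q : Fin I.items → Bool) {a : Fin I.items} (ha : q a = true) :
    I.reachProb b l a ≤ I.reachProb b (l.filter q) a := by
  induction l with
  | nil => simp
  | cons c l ih =>
    have h1 := mul_le_mul_of_nonneg_left ih (I.one_sub_prob_nonneg c b)
    by_cases hc : q c = true
    · rw [List.filter_cons_of_pos hc]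
      simp only [reachProb]
      linarith
    · rw [List.filter_cons_of_neg hc]
      have hac : a ≠ c := by rintro rfl; exact hc ha
      have := mul_nonneg (I.prob_real_nonneg c b) (I.reachProb_nonneg b (l.filter q) a)
      simp only [reachProb, if_neg hac]
      linarith

/-- Writes the outcome of adaptive probing as a linear functional of the reach probabilities, so
that lists can be compared with fractional solutions. -/
theorem probeValue_eq (I : Instance) (b : Fin I.types) (V : Option (Fin I.items) → ℝ)
    (l : List (Fin I.items)) :
    I.probeValue b V l = V none + ∑ a, (I.prob a b : ℝ) * I.reachProb b l a *
      ((I.profit a b : ℝ) + V (some a) - V none) := by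
  induction l with
  | nil => simp [probeValue, reachProb]
  | cons c l ih =>
    have : ∀ a, (I.prob a b : ℝ) * I.reachProb b (c :: l) a *
        ((I.profit a b : ℝ) + V (some a) - V none) =
        (if a = c then (I.prob a b : ℝ) * ((I.profit a b : ℝ) + V (some a) - V none) else 0) +
          (1 - I.prob c b) * ((I.prob a b : ℝ) * I.reachProb b l a *
            ((I.profit a b : ℝ) + V (some a) - V none)) := by
      intro a; simp only [reachProb]; split_ifs <;> ring
    simp only [this, Finset.sum_add_distrib, ← Finset.mul_sum, Finset.sum_ite_eq',
      Finset.mem_univ, if_true, probeValue, ih]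
    ring

theorem probeValue_mono (I : Instance) (b : Fin I.types) {V W : Option (Fin I.items) → ℝ}
    {l : List (Fin I.items)} (h0 : V none ≤ W none) (h : ∀ a ∈ l, V (some a) ≤ W (some a)) :
    I.probeValue b V l ≤ I.probeValue b W l := by
  induction l with
  | nil => simpa [probeValue]
  | cons c l ih =>
    have h1 := mul_le_mul_of_nonneg_left (h c (by simp)) (I.prob_real_nonneg c b)
    have h2 := mul_le_mul_of_nonneg_left (ih fun a ha => h a (by simp [ha]))
      (I.one_sub_prob_nonneg c b)
    simp only [probeValue]
    linarith

/-! ### Greedy offers for one buyer -/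

/-- The increase of the expected profit `G` of a list when `a` is offered before the list,
if items have the opportunity costs `v`. -/
noncomputable def surplus (I : Instance) (v : Fin I.items → ℝ) (b : Fin I.types) (G : ℝ)
    (a : Fin I.items) : ℝ :=
  (I.prob a b : ℝ) * ((I.profit a b : ℝ) - v a - G)

open Classical in
/-- The first item of largest positive surplus outside of `l` among the first `k` items, and
this surplus. -/
noncomputable def bestItem (I : Instance) (v : Fin I.items → ℝ) (b : Fin I.types) (G : ℝ)
    (l : List (Fin I.items)) : ℕ → Option (Fin I.items) × ℝ
  | 0 => (none, 0)
  | k + 1 =>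
    if h : k < I.items then
      if (⟨k, h⟩ : Fin I.items) ∉ l ∧ (bestItem I v b G l k).2 < I.surplus v b G ⟨k, h⟩ then
        (some ⟨k, h⟩, I.surplus v b G ⟨k, h⟩)
      else bestItem I v b G l k
    else bestItem I v b G l k

/-- The list obtained by at most `s` times putting the best item in front, and its expected
profit. -/
noncomputable def greedy (I : Instance) (v : Fin I.items → ℝ) (b : Fin I.types) :
    ℕ → ℝ × List (Fin I.items)
  | 0 => (0, [])
  | s + 1 =>
    match I.bestItem v b (greedy I v b s).1 (greedy I v b s).2 I.items with
    | (some a, m) =>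
      if (greedy I v b s).2.length < I.timeout b then
        ((greedy I v b s).1 + m, a :: (greedy I v b s).2)
      else greedy I v b s
    | (none, _) => greedy I v b s

theorem bestItem_nonneg (I : Instance) (v : Fin I.items → ℝ) (b : Fin I.types) (G : ℝ)
    (l : List (Fin I.items)) (k : ℕ) : 0 ≤ (I.bestItem v b G l k).2 := by
  induction k with
  | zero => simp [bestItem]
  | succ k ih =>
    rw [bestItem]
    split_ifs with h h'
    · exact ih.trans h'.2.le
    · exact ih
    · exact ih

theorem surplus_le_bestItem (I : Instance) (v : Fin I.items → ℝ) (b : Fin I.types) (G : ℝ)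
    (l : List (Fin I.items)) (k : ℕ) (a : Fin I.items) (ha : a ∉ l) (hk : a.val < k) :
    I.surplus v b G a ≤ (I.bestItem v b G l k).2 := by
  induction k with
  | zero => omega
  | succ k ih =>
    rw [bestItem]
    rcases Nat.lt_succ_iff_lt_or_eq.1 hk with h1 | h1
    · have := ih h1
      split_ifs with h h'
      · exact this.trans h'.2.le
      · exact this
      · exact this
    · have hk' : k < I.items := h1 ▸ a.2
      have hak : a = ⟨k, hk'⟩ := Fin.ext h1
      rw [dif_pos hk']
      split_ifs with h'
      · rw [hak]
      · rw [hak] at ha ⊢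
        exact not_lt.1 fun h2 => h' ⟨ha, h2⟩

theorem bestItem_none (I : Instance) (v : Fin I.items → ℝ) (b : Fin I.types) (G : ℝ)
    (l : List (Fin I.items)) (k : ℕ) (h : (I.bestItem v b G l k).1 = none) :
    (I.bestItem v b G l k).2 = 0 := by
  induction k with
  | zero => simp [bestItem]
  | succ k ih =>
    rw [bestItem] at h ⊢
    split_ifs at h ⊢
    · exact ih h
    · exact ih h

theorem bestItem_some (I : Instance) (v : Fin I.items → ℝ) (b : Fin I.types) (G : ℝ)
    (l : List (Fin I.items)) (k : ℕ) (a : Fin I.items) (h : (I.bestItem v b G l k).1 = some a) :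
    a ∉ l ∧ (I.bestItem v b G l k).2 = I.surplus v b G a ∧ 0 < I.surplus v b G a := by
  induction k with
  | zero => simp [bestItem] at h
  | succ k ih =>
    rw [bestItem] at h ⊢
    split_ifs at h ⊢ with h1 h2
    · simp only [Option.some.injEq] at h
      subst h
      exact ⟨h2.1, rfl, (I.bestItem_nonneg v b G l k).trans_lt h2.2⟩
    · exact ih h
    · exact ih h

/-- The properties of greedy lists used below; `m` are the increments of the expected profit. -/
structure GreedySpec (I : Instance) (v : Fin I.items → ℝ) (b : Fin I.types) (G : ℝ)
    (l : List (Fin I.items)) (m : Fin I.items → ℝ) : Prop where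
  nodup : l.Nodup
  length_le : l.length ≤ I.timeout b
  nonneg : 0 ≤ G
  eq_sum : G = ∑ a, (I.prob a b : ℝ) * I.reachProb b l a * ((I.profit a b : ℝ) - v a)
  cost_le : ∀ a ∈ l, v a ≤ I.profit a b
  m_nonneg : ∀ a ∈ l, 0 ≤ m a
  sum_m : (l.map m).sum = G
  surplus_le : ∀ a ∈ l, I.surplus v b G a ≤ m a
  surplus_le_of_notMem : ∀ a ∉ l, ∀ c ∈ l, I.surplus v b G a ≤ m c

theorem surplus_anti (I : Instance) (v : Fin I.items → ℝ) (b : Fin I.types) {G G' : ℝ}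
    (h : G ≤ G') (a : Fin I.items) : I.surplus v b G' a ≤ I.surplus v b G a :=
  mul_le_mul_of_nonneg_left (by linarith) (I.prob_real_nonneg a b)

/-- Surpluses decrease as `G` grows, so every bound by an earlier increment survives. The new
increment dominates the surpluses of the items still outside because `c` was a best choice. -/
theorem GreedySpec.cons {I : Instance} {v : Fin I.items → ℝ} {b : Fin I.types} {G : ℝ}
    {l : List (Fin I.items)} {m : Fin I.items → ℝ} (H : I.GreedySpec v b G l m)
    (hl : l.length < I.timeout b) {c : Fin I.items} (hc : c ∉ l)
    (hpos : 0 < I.surplus v b G c) (hmax : ∀ a ∉ l, I.surplus v b G a ≤ I.surplus v b G c) :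
    I.GreedySpec v b (G + I.surplus v b G c) (c :: l)
      (Function.update m c (I.surplus v b G c)) := by
  have hG : G ≤ G + I.surplus v b G c := by linarith
  have hm : ∀ a ∈ l, Function.update m c (I.surplus v b G c) a = m a := fun a ha =>
    Function.update_of_ne (by rintro rfl; exact hc ha) _ _
  constructor
  · exact List.nodup_cons.2 ⟨hc, H.nodup⟩
  · simpa using hl
  · linarith [H.nonneg]
  · have : ∀ a, (I.prob a b : ℝ) * I.reachProb b (c :: l) a * ((I.profit a b : ℝ) - v a) =
        (if a = c then (I.prob a b : ℝ) * ((I.profit a b : ℝ) - v a) else 0) +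
          (1 - I.prob c b) *
            ((I.prob a b : ℝ) * I.reachProb b l a * ((I.profit a b : ℝ) - v a)) := by
      intro a; simp only [reachProb]; split_ifs <;> ring
    simp only [this, Finset.sum_add_distrib, ← Finset.mul_sum, ← H.eq_sum, Finset.sum_ite_eq',
      Finset.mem_univ, if_true, surplus]
    ring
  · intro a ha
    rcases List.mem_cons.1 ha with rfl | ha
    · have := (pos_iff_pos_of_mul_pos hpos).1 (by exact_mod_cast I.prob_pos a b)
      linarith [H.nonneg]
    · exact H.cost_le a ha
  · intro a ha
    rcases List.mem_cons.1 ha with rfl | ha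
    · simpa using hpos.le
    · rw [hm a ha]; exact H.m_nonneg a ha
  · rw [List.map_cons, List.sum_cons, Function.update_self, List.map_congr_left hm, H.sum_m]
    ring
  · intro a ha
    rcases List.mem_cons.1 ha with rfl | ha
    · rw [Function.update_self]; exact I.surplus_anti v b hG a
    · rw [hm a ha]; exact (I.surplus_anti v b hG a).trans (H.surplus_le a ha)
  · intro a ha d hd
    simp only [List.mem_cons, not_or] at ha
    refine (I.surplus_anti v b hG a).trans ?_
    rcases List.mem_cons.1 hd with rfl | hd
    · rw [Function.update_self]; exact hmax a ha.2
    · rw [hm d hd]; exact H.surplus_le_of_notMem a ha.2 d hd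

/-- The second part lists the reasons for a list to be no longer: too few steps so far, the timeout,
or no item left to gain from. With `s = I.items` the first reason means that all items are in the
list. -/
theorem greedy_spec (I : Instance) (v : Fin I.items → ℝ) (b : Fin I.types) (s : ℕ) :
    (∃ m, I.GreedySpec v b (I.greedy v b s).1 (I.greedy v b s).2 m) ∧
      ((I.greedy v b s).2.length = s ∨ (I.greedy v b s).2.length = I.timeout b ∨
        ∀ a ∉ (I.greedy v b s).2, I.surplus v b (I.greedy v b s).1 a ≤ 0) := by
  induction s with
  | zero =>
    exact ⟨⟨0, by constructor <;> simp [greedy, reachProb]⟩, Or.inl rfl⟩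
  | succ s ih =>
    obtain ⟨⟨m, H⟩, hterm⟩ := ih
    rw [greedy]
    rcases hb : I.bestItem v b (I.greedy v b s).1 (I.greedy v b s).2 I.items with ⟨_ | a, q⟩
    · refine ⟨⟨m, H⟩, Or.inr (Or.inr fun a ha => ?_)⟩
      have h1 := I.surplus_le_bestItem v b (I.greedy v b s).1 (I.greedy v b s).2 I.items a ha a.2
      rwa [I.bestItem_none v b _ _ _ (by rw [hb])] at h1
    · have h1 := I.bestItem_some v b _ _ _ a (by rw [hb])
      have h2 := fun c hc => I.surplus_le_bestItem v b (I.greedy v b s).1 (I.greedy v b s).2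
        I.items c hc c.2
      rw [hb] at h1 h2
      obtain ⟨ha, rfl, hpos⟩ := h1
      simp only
      split_ifs with hlt
      · refine ⟨⟨_, H.cons hlt ha hpos h2⟩, ?_⟩
        rcases hterm with h | h | h
        · left; simp [h]
        · omega
        · exact absurd (h a ha) (not_le.2 hpos)
      · exact ⟨⟨m, H⟩, Or.inr (Or.inl (le_antisymm H.length_le (not_lt.1 hlt)))⟩

/-- The expected profit of the greedy list. -/
noncomputable def greedyValue (I : Instance) (v : Fin I.items → ℝ) (b : Fin I.types) : ℝ :=
  (I.greedy v b I.items).1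

/-- The greedy list. -/
noncomputable def greedyList (I : Instance) (v : Fin I.items → ℝ) (b : Fin I.types) :
    List (Fin I.items) :=
  (I.greedy v b I.items).2

theorem greedyList_spec (I : Instance) (v : Fin I.items → ℝ) (b : Fin I.types) :
    ∃ m, I.GreedySpec v b (I.greedyValue v b) (I.greedyList v b) m :=
  (I.greedy_spec v b I.items).1

/-- The greedy list is a `2`-approximation with respect to the linear program for one buyer. -/
theorem sum_le_two_mul_greedyValue (I : Instance) (v : Fin I.items → ℝ) (b : Fin I.types)
    (x : Fin I.items → ℝ) (h0 : ∀ a, 0 ≤ x a) (h1 : ∀ a, x a ≤ 1)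
    (hp : ∑ a, (I.prob a b : ℝ) * x a ≤ 1) (ht : ∑ a, x a ≤ I.timeout b) :
    ∑ a, (I.prob a b : ℝ) * x a * ((I.profit a b : ℝ) - v a) ≤ 2 * I.greedyValue v b := by
  obtain ⟨⟨m, H⟩, hterm⟩ := I.greedy_spec v b I.items
  change I.GreedySpec v b (I.greedyValue v b) (I.greedyList v b) m at H
  change (I.greedyList v b).length = _ ∨ (I.greedyList v b).length = _ ∨
    ∀ a ∉ I.greedyList v b, I.surplus v b (I.greedyValue v b) a ≤ 0 at hterm
  generalize I.greedyValue v b = G at *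
  generalize I.greedyList v b = l at *
  -- The net profit splits into `G` plus the rest. The first part is at most `G` by the buyer
  -- constraint, the second by comparison with the increments: this gives the factor 2.
  have hsplit : ∑ a, (I.prob a b : ℝ) * x a * ((I.profit a b : ℝ) - v a) =
      G * ∑ a, (I.prob a b : ℝ) * x a + ∑ a, x a * I.surplus v b G a := by
    rw [Finset.mul_sum, ← Finset.sum_add_distrib]
    exact Finset.sum_congr rfl fun a _ => by simp only [surplus]; ring
  have hGp : G * ∑ a, (I.prob a b : ℝ) * x a ≤ G := mul_le_of_le_one_right H.nonneg hp
  have hsum : ∀ f : Fin I.items → ℝ, ∑ a ∈ l.toFinset, f a = (l.map f).sum := fun f =>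
    List.sum_toFinset f H.nodup
  -- `β` is the dual variable of the timeout constraint: the least increment if the list has full
  -- length, and zero if nothing outside has positive surplus.
  obtain ⟨β, hβ0, hβ1, hβ2, hβ3⟩ : ∃ β : ℝ, 0 ≤ β ∧ (∀ a ∈ l, β ≤ m a) ∧
      (∀ a ∉ l, I.surplus v b G a ≤ β) ∧ (β = 0 ∨ l.length = I.timeout b) := by
    by_cases hfin : ∀ a ∉ l, I.surplus v b G a ≤ 0
    · exact ⟨0, le_rfl, H.m_nonneg, hfin, Or.inl rfl⟩
    · have hlen : l.length = I.timeout b := by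
        rcases hterm with h | h | h
        · refine absurd (fun a ha => absurd ?_ ha) hfin
          have : l.toFinset = Finset.univ := by
            rw [← Finset.card_eq_iff_eq_univ, List.toFinset_card_of_nodup H.nodup, h,
              Fintype.card_fin]
          simpa using (this ▸ Finset.mem_univ a : a ∈ l.toFinset)
        · exact h
        · exact absurd h hfin
      have hne : l.toFinset.Nonempty := by
        rw [List.toFinset_nonempty_iff]
        rintro rfl
        have := I.timeout_pos b
        simp at hlen; omega
      obtain ⟨c, hc, hmin⟩ := l.toFinset.exists_min_image m hne
      rw [List.mem_toFinset] at hc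
      exact ⟨m c, H.m_nonneg c hc, fun a ha => hmin a (List.mem_toFinset.2 ha),
        fun a ha => H.surplus_le_of_notMem a ha c hc, Or.inr hlen⟩
  have hmain : ∑ a, x a * I.surplus v b G a ≤ G := by
    have hs : ∑ a, x a * I.surplus v b G a ≤
        ∑ a ∈ l.toFinset, (x a * (m a - β)) + β * ∑ a, x a := by
      rw [Finset.mul_sum, ← Finset.sum_add_sum_compl l.toFinset,
        ← Finset.sum_add_sum_compl l.toFinset fun a => β * x a, ← add_assoc,
        ← Finset.sum_add_distrib]
      refine add_le_add (Finset.sum_le_sum fun a ha => ?_) (Finset.sum_le_sum fun a ha => ?_)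
      · have := mul_le_mul_of_nonneg_left (H.surplus_le a (List.mem_toFinset.1 ha)) (h0 a)
        linarith
      · rw [Finset.mem_compl, List.mem_toFinset] at ha
        have := mul_le_mul_of_nonneg_left (hβ2 a ha) (h0 a)
        linarith
    have hx : ∑ a ∈ l.toFinset, (x a * (m a - β)) ≤ ∑ a ∈ l.toFinset, (m a - β) :=
      Finset.sum_le_sum fun a ha => mul_le_of_le_one_left
        (sub_nonneg.2 (hβ1 a (List.mem_toFinset.1 ha))) (h1 a)
    have hb : β * ∑ a, x a ≤ β * l.length := by
      rcases hβ3 with h | h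
      · simp [h]
      · rw [h]; exact mul_le_mul_of_nonneg_left ht hβ0
    have he : ∑ a ∈ l.toFinset, (m a - β) = G - β * l.length := by
      rw [Finset.sum_sub_distrib, hsum, H.sum_m, Finset.sum_const,
        List.toFinset_card_of_nodup H.nodup, nsmul_eq_mul, mul_comm]
    linarith
  linarith

/-! ### Prices of the items -/

/-- The prices after a further buyer type has been taken into account. -/
noncomputable def priceUpdate (I : Instance) (v : Fin I.items → ℝ) (b : Fin I.types)
    (l : List (Fin I.items)) (a : Fin I.items) : ℝ :=
  v a + ((I.mult b : ℝ) / (I.rounds : ℝ)) * ((I.prob a b : ℝ) * I.reachProb b l a *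
    ((I.profit a b : ℝ) - v a))

/-- The buyer type treated in step `j` of the computation of prices. -/
def stepType (I : Instance) (h : 0 < I.types) (j : ℕ) : Fin I.types :=
  ⟨j % I.types, Nat.mod_lt _ h⟩

/-- The prices of the items after `j` steps: after `k * types + b` steps, the last `k` rounds and,
in the round before these, the first `b` types have been taken into account. -/
noncomputable def price (I : Instance) : ℕ → Fin I.items → ℝ
  | 0 => fun _ => 0
  | j + 1 =>
    if h : 0 < I.types then
      I.priceUpdate (price I j) (I.stepType h j) (I.greedyList (price I j) (I.stepType h j))
    else price I j

/-- A positive surplus over a nonnegative `G` forces profit above cost, so greedy lists contain no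
item with a negative margin. -/
theorem le_priceUpdate (I : Instance) (v : Fin I.items → ℝ) (b : Fin I.types)
    (a : Fin I.items) : v a ≤ I.priceUpdate v b (I.greedyList v b) a := by
  obtain ⟨m, H⟩ := I.greedyList_spec v b
  refine le_add_of_nonneg_right (mul_nonneg (by positivity) ?_)
  by_cases ha : a ∈ I.greedyList v b
  · exact mul_nonneg (mul_nonneg (I.prob_real_nonneg a b) (I.reachProb_nonneg b _ a))
      (sub_nonneg.2 (H.cost_le a ha))
  · simp [I.reachProb_eq_zero b ha]

theorem price_mono (I : Instance) (a : Fin I.items) : Monotone fun j => I.price j a := by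
  refine monotone_nat_of_le_succ fun j => ?_
  simp only [price]
  split_ifs with h
  · exact I.le_priceUpdate _ _ a
  · exact le_rfl

theorem price_nonneg (I : Instance) (j : ℕ) (a : Fin I.items) : 0 ≤ I.price j a :=
  I.price_mono a (Nat.zero_le j)

theorem price_mul_add (I : Instance) (k : ℕ) (b : Fin I.types) :
    I.price (k * I.types + b + 1) = I.priceUpdate (I.price (k * I.types + b)) b
      (I.greedyList (I.price (k * I.types + b)) b) := by
  have h : 0 < I.types := b.pos
  have hb : I.stepType h (k * I.types + b) = b := by
    apply Fin.ext
    simp [stepType, Nat.mul_comm k, Nat.mod_eq_of_lt b.2]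
  simp only [price, dif_pos h, hb]

/-- Prices change after each type and not only after each round, so type `b` sees the updates made
for earlier types of the same round. The increments of a round telescope nevertheless. -/
theorem price_round (I : Instance) (k : ℕ) (a : Fin I.items) :
    I.price ((k + 1) * I.types) a = I.price (k * I.types) a +
      ∑ b, ((I.mult b : ℝ) / (I.rounds : ℝ)) * ((I.prob a b : ℝ) *
        I.reachProb b (I.greedyList (I.price (k * I.types + b)) b) a *
          ((I.profit a b : ℝ) - I.price (k * I.types + b) a)) := by
  have h1 : ∀ b : Fin I.types, ((I.mult b : ℝ) / (I.rounds : ℝ)) * ((I.prob a b : ℝ) *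
        I.reachProb b (I.greedyList (I.price (k * I.types + b)) b) a *
          ((I.profit a b : ℝ) - I.price (k * I.types + b) a)) =
      I.price (k * I.types + (b + 1)) a - I.price (k * I.types + b) a := by
    intro b
    rw [← add_assoc, I.price_mul_add k b, priceUpdate]
    ring
  simp only [h1]
  rw [Fin.sum_univ_eq_sum_range (fun b => I.price (k * I.types + (b + 1)) a -
    I.price (k * I.types + b) a), Finset.sum_range_sub fun b => I.price (k * I.types + b) a,
    Nat.succ_mul]
  ring_nf

/-- What the list of a type draws from all items together is its greedy value, by
`GreedySpec.eq_sum`. -/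
theorem sum_price_round (I : Instance) (k : ℕ) :
    ∑ b, ((I.mult b : ℝ) / (I.rounds : ℝ)) * I.greedyValue (I.price (k * I.types + b)) b =
      ∑ a, I.price ((k + 1) * I.types) a - ∑ a, I.price (k * I.types) a := by
  rw [← Finset.sum_sub_distrib]
  simp only [I.price_round k, add_sub_cancel_left]
  rw [Finset.sum_comm]
  refine Finset.sum_congr rfl fun b _ => ?_
  obtain ⟨m, H⟩ := I.greedyList_spec (I.price (k * I.types + b)) b
  rw [← Finset.mul_sum, ← H.eq_sum]

/-! ### The upper bound for the linear program -/

/-- The prices at the beginning. -/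
noncomputable def startPrice (I : Instance) (a : Fin I.items) : ℝ :=
  I.price (I.rounds * I.types) a

/-- A bound for the profit from a buyer of type `b` that exceeds the prices. -/
noncomputable def buyerBound (I : Instance) (b : Fin I.types) : ℝ :=
  (∑ k ∈ Finset.range I.rounds, 2 * I.greedyValue (I.price (k * I.types + b)) b) / I.rounds

theorem sum_buyerBound (I : Instance) :
    ∑ b, (I.mult b : ℝ) * I.buyerBound b = 2 * ∑ a, I.startPrice a := by
  have h : ∑ a, I.startPrice a = ∑ k ∈ Finset.range I.rounds,
      ∑ b, ((I.mult b : ℝ) / (I.rounds : ℝ)) * I.greedyValue (I.price (k * I.types + b)) b := by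
    simp only [I.sum_price_round]
    rw [Finset.sum_range_sub fun k => ∑ a, I.price (k * I.types) a]
    simp [startPrice, price]
  rw [h, Finset.sum_comm, Finset.mul_sum]
  refine Finset.sum_congr rfl fun b _ => ?_
  rw [buyerBound, Finset.sum_div, Finset.mul_sum, Finset.mul_sum]
  exact Finset.sum_congr rfl fun k _ => by ring

/-- Start prices are the highest, so replacing them by the prices of any round only enlarges the
left side, and the greedy 2-approximation applies. Averaging over the rounds keeps the inequality.
-/
theorem sum_le_buyerBound (I : Instance) (hn : 0 < I.rounds) (b : Fin I.types)
    (x : Fin I.items → ℝ) (h0 : ∀ a, 0 ≤ x a) (h1 : ∀ a, x a ≤ 1)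
    (hp : ∑ a, (I.prob a b : ℝ) * x a ≤ 1) (ht : ∑ a, x a ≤ I.timeout b) :
    ∑ a, (I.prob a b : ℝ) * x a * ((I.profit a b : ℝ) - I.startPrice a) ≤ I.buyerBound b := by
  have hn' : (0 : ℝ) < I.rounds := by exact_mod_cast hn
  rw [buyerBound, le_div_iff₀ hn', mul_comm, ← nsmul_eq_mul]
  nth_rw 1 [← Finset.card_range I.rounds]
  refine Finset.card_nsmul_le_sum _ _ _ fun k hk => ?_
  refine le_trans ?_ (I.sum_le_two_mul_greedyValue (I.price (k * I.types + b)) b x h0 h1 hp ht)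
  refine Finset.sum_le_sum fun a _ => mul_le_mul_of_nonneg_left ?_
    (mul_nonneg (I.prob_real_nonneg a b) (h0 a))
  refine sub_le_sub_left (I.price_mono a ?_) _
  have h2 := Finset.mem_range.1 hk
  calc k * I.types + b ≤ (k + 1) * I.types := by rw [Nat.succ_mul]; have := b.2; omega
    _ ≤ _ := Nat.mul_le_mul_right _ h2

theorem rounds_pos (I : Instance) {b : Fin I.types} (h : 0 < I.mult b) : 0 < I.rounds :=
  h.trans_le (Finset.single_le_sum (f := I.mult) (fun _ _ => Nat.zero_le _) (Finset.mem_univ b))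

/-- Weak duality: charge each item its start price through the item constraint, and bound what
remains separately for each copy of a buyer type. -/
theorem lpValue_le (I : Instance) (x : Fin I.items → (b : Fin I.types) → Fin (I.mult b) → ℝ)
    (hx : I.LPFeasible x) : I.lpValue x ≤ 3 * ∑ a, I.startPrice a := by
  have h1 : I.lpValue x = ∑ a, I.startPrice a * (∑ b, ∑ j, (I.prob a b : ℝ) * x a b j) +
      ∑ b, ∑ j, ∑ a, (I.prob a b : ℝ) * x a b j * ((I.profit a b : ℝ) - I.startPrice a) := by
    have : ∀ b, (∑ j, ∑ a, (I.prob a b : ℝ) * x a b j * ((I.profit a b : ℝ) - I.startPrice a)) =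
        ∑ a, ∑ j, (I.prob a b : ℝ) * x a b j * ((I.profit a b : ℝ) - I.startPrice a) :=
      fun b => Finset.sum_comm
    simp only [this]
    rw [Finset.sum_comm (s := (Finset.univ : Finset (Fin I.types))), ← Finset.sum_add_distrib,
      lpValue]
    simp only [Finset.mul_sum, ← Finset.sum_add_distrib]
    refine Finset.sum_congr rfl fun a _ => Finset.sum_congr rfl fun b _ =>
      Finset.sum_congr rfl fun j _ => by ring
  have h2 : ∑ a, I.startPrice a * (∑ b, ∑ j, (I.prob a b : ℝ) * x a b j) ≤
      ∑ a, I.startPrice a :=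
    Finset.sum_le_sum fun a _ => mul_le_of_le_one_right (I.price_nonneg _ a) (hx.item_le a)
  have h3 : ∑ b, ∑ j, ∑ a, (I.prob a b : ℝ) * x a b j * ((I.profit a b : ℝ) - I.startPrice a) ≤
      ∑ b, (I.mult b : ℝ) * I.buyerBound b := by
    refine Finset.sum_le_sum fun b _ => ?_
    calc _ ≤ ∑ _j : Fin (I.mult b), I.buyerBound b :=
          Finset.sum_le_sum fun j _ => I.sum_le_buyerBound (I.rounds_pos j.pos) b
            (fun a => x a b j) (fun a => hx.nonneg a b j) (fun a => hx.le_one a b j)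
            (hx.buyer_le b j) (hx.timeout_le b j)
      _ = _ := by simp
  rw [I.sum_buyerBound] at h3
  linarith

/-! ### Available items -/

/-- The item `a` has not been matched before. -/
def Available (I : Instance) (h : I.History) (a : Fin I.items) : Prop := ∀ r ∈ h, r.2 ≠ some a

instance (I : Instance) (h : I.History) : DecidablePred (I.Available h) := fun a =>
  inferInstanceAs (Decidable (∀ r ∈ h, r.2 ≠ some a))

/-- The total price of the available items. -/
noncomputable def totalPrice (I : Instance) (v : Fin I.items → ℝ) (h : I.History) : ℝ :=
  ∑ a, if I.Available h a then v a else 0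

theorem totalPrice_cons_none (I : Instance) (v : Fin I.items → ℝ) (h : I.History)
    (b : Fin I.types) : I.totalPrice v ((b, none) :: h) = I.totalPrice v h := by
  simp [totalPrice, Available]

theorem totalPrice_cons_some (I : Instance) (v : Fin I.items → ℝ) (h : I.History)
    (b : Fin I.types) (c : Fin I.items) (hc : I.Available h c) :
    I.totalPrice v ((b, some c) :: h) = I.totalPrice v h - v c := by
  have h1 : ∀ a, (if I.Available ((b, some c) :: h) a then v a else 0) =
      (if I.Available h a then v a else 0) - if a = c then v a else 0 := by
    intro a
    by_cases hac : a = c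
    · subst hac
      have : ¬ I.Available ((b, some a) :: h) a := by simp [Available]
      simp [this, hc]
    · have : I.Available ((b, some c) :: h) a ↔ I.Available h a := by
        simp [Available, Ne.symm hac]
      simp [this, hac]
  simp [totalPrice, h1, Finset.sum_sub_distrib]

theorem sum_mult_div_rounds (I : Instance) (h : 0 < I.rounds) :
    ∑ b, ((I.mult b : ℝ) / (I.rounds : ℝ)) = 1 := by
  rw [← Finset.sum_div, ← Nat.cast_sum]
  exact div_self (by exact_mod_cast h.ne')

/-- For lists of available items, the prices are the opportunity costs. -/
theorem probeValue_totalPrice (I : Instance) (v : Fin I.items → ℝ) (h : I.History)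
    (b : Fin I.types) (l : List (Fin I.items)) (hl : ∀ a ∈ l, I.Available h a) (C : ℝ) :
    I.probeValue b (fun m => I.totalPrice v ((b, m) :: h) + C) l = I.totalPrice v h + C +
      ∑ a, (I.prob a b : ℝ) * I.reachProb b l a * ((I.profit a b : ℝ) - v a) := by
  rw [I.probeValue_eq, I.totalPrice_cons_none]
  congr 1
  refine Finset.sum_congr rfl fun a _ => ?_
  by_cases ha : a ∈ l
  · rw [I.totalPrice_cons_some v h b a (hl a ha)]
    ring
  · simp [I.reachProb_eq_zero b ha]

/-! ### The upper bound for policies -/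

/-- A potential argument: a matched item takes its start price out of the potential, and the net
profit above this price is at most `buyerBound`, since reach probabilities of a feasible list solve
the one-buyer linear program. -/
theorem valueFrom_le (I : Instance) (π : I.Policy) (hπ : π.Feasible) (k : ℕ) (h : I.History)
    (hk : h.length + k = I.rounds) :
    π.valueFrom k h ≤ I.totalPrice I.startPrice h +
      k * ∑ b, ((I.mult b : ℝ) / (I.rounds : ℝ)) * I.buyerBound b := by
  induction k generalizing h with
  | zero =>
    simp only [Policy.valueFrom, Nat.cast_zero, zero_mul, add_zero]
    refine Finset.sum_nonneg fun a _ => ?_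
    split_ifs
    · exact I.price_nonneg _ a
    · exact le_rfl
  | succ k ih =>
    have hn : 0 < I.rounds := by omega
    set D := ∑ b, ((I.mult b : ℝ) / (I.rounds : ℝ)) * I.buyerBound b with hD
    simp only [Policy.valueFrom]
    calc _ ≤ ∑ b, ((I.mult b : ℝ) / (I.rounds : ℝ)) *
          (I.totalPrice I.startPrice h + k * D + I.buyerBound b) := by
          refine Finset.sum_le_sum fun b _ => mul_le_mul_of_nonneg_left ?_ (by positivity)
          obtain ⟨hnd, hlen, hav⟩ := hπ h b (by omega)
          have h1 : ∀ m, π.valueFrom k ((b, m) :: h) ≤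
              I.totalPrice I.startPrice ((b, m) :: h) + k * D := fun m =>
            ih _ (by simp; omega)
          refine (I.probeValue_mono b (W := fun m =>
            I.totalPrice I.startPrice ((b, m) :: h) + k * D) (h1 _) fun a _ => h1 _).trans ?_
          rw [I.probeValue_totalPrice I.startPrice h b (π h b) hav]
          refine add_le_add le_rfl (I.sum_le_buyerBound hn b _ (I.reachProb_nonneg b _)
            (I.reachProb_le_one b hnd) ?_ ?_)
          · rw [I.sum_prob_mul_reachProb]
            linarith [I.missProb_nonneg b (π h b)]
          · exact (I.sum_reachProb_le_length b _).trans (by exact_mod_cast hlen)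
      _ = _ := by
          simp only [mul_add (_ / _) (_ + _) (_ : ℝ), Finset.sum_add_distrib, ← Finset.sum_mul,
            I.sum_mult_div_rounds hn, ← hD]
          push_cast
          ring

theorem totalPrice_nil (I : Instance) (v : Fin I.items → ℝ) :
    I.totalPrice v [] = ∑ a, v a := by
  simp [totalPrice, Available]

theorem sum_startPrice_nonneg (I : Instance) : 0 ≤ ∑ a, I.startPrice a :=
  Finset.sum_nonneg fun a _ => I.price_nonneg _ a

theorem expectedProfit_le (I : Instance) (π : I.Policy) (hπ : π.Feasible) :
    π.expectedProfit ≤ 3 * ∑ a, I.startPrice a := by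
  have h1 := I.valueFrom_le π hπ I.rounds [] (by simp)
  rw [I.totalPrice_nil] at h1
  -- Without rounds the arrival probabilities are divisions by zero, so cancelling `I.rounds` needs
  -- the second case.
  rcases Nat.eq_zero_or_pos I.rounds with h | h
  · rw [Policy.expectedProfit]
    rw [h] at h1 ⊢
    have := I.sum_startPrice_nonneg
    simp only [Nat.cast_zero, zero_mul, add_zero] at h1
    linarith
  · have h2 : (I.rounds : ℝ) * ∑ b, ((I.mult b : ℝ) / (I.rounds : ℝ)) * I.buyerBound b =
        2 * ∑ a, I.startPrice a := by
      rw [← I.sum_buyerBound, Finset.mul_sum]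
      refine Finset.sum_congr rfl fun b _ => ?_
      have : (I.rounds : ℝ) ≠ 0 := by exact_mod_cast h.ne'
      field_simp
    rw [h2] at h1
    rw [Policy.expectedProfit]
    linarith

theorem opt_le (I : Instance) : I.opt ≤ 3 * ∑ a, I.startPrice a := by
  refine csSup_le I.optValues_nonempty ?_
  rintro v ⟨π, hπ, rfl⟩
  exact I.expectedProfit_le π hπ

theorem lpOnl_le (I : Instance) : I.lpOnl ≤ 3 * ∑ a, I.startPrice a := by
  refine csSup_le I.lpValues_nonempty ?_
  rintro v ⟨x, hx, rfl⟩
  exact I.lpValue_le x hx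

/-! ### The policy -/

/-- Offer the available items of the greedy list for the current prices. -/
noncomputable def pricePolicy (I : Instance) : I.Policy := fun h b =>
  (I.greedyList (I.price ((I.rounds - 1 - h.length) * I.types + b)) b).filter
    fun a => decide (I.Available h a)

theorem pricePolicy_feasible (I : Instance) : I.pricePolicy.Feasible := by
  intro h b _
  obtain ⟨m, H⟩ := I.greedyList_spec (I.price ((I.rounds - 1 - h.length) * I.types + b)) b
  refine ⟨H.nodup.filter _, (List.length_filter_le _ _).trans H.length_le, fun a ha => ?_⟩
  exact of_decide_eq_true (List.mem_filter.1 ha).2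

/-- By induction the continuation is worth at least the prices for `k` rounds. The price increments
of a round are thus to be covered by the net profit of that round, and only those of available items
count. -/
theorem le_valueFrom_pricePolicy (I : Instance) (k : ℕ) (h : I.History)
    (hk : h.length + k = I.rounds) :
    I.totalPrice (I.price (k * I.types)) h ≤ I.pricePolicy.valueFrom k h := by
  induction k generalizing h with
  | zero => simp [Policy.valueFrom, totalPrice, price]
  | succ k ih =>
    have hn : 0 < I.rounds := by omega
    set v := I.price (k * I.types) with hv
    simp only [Policy.valueFrom]
    let g : Fin I.types → Fin I.items → ℝ := fun b a => (I.prob a b : ℝ) *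
        I.reachProb b (I.greedyList (I.price (k * I.types + b)) b) a *
          ((I.profit a b : ℝ) - I.price (k * I.types + b) a)
    calc I.totalPrice (I.price ((k + 1) * I.types)) h = ∑ b, ((I.mult b : ℝ) / (I.rounds : ℝ)) *
          (I.totalPrice v h + ∑ a, if I.Available h a then g b a else 0) := by
          simp only [mul_add, Finset.sum_add_distrib, ← Finset.sum_mul,
            I.sum_mult_div_rounds hn, one_mul, Finset.mul_sum]
          rw [Finset.sum_comm, totalPrice, totalPrice, ← Finset.sum_add_distrib]
          refine Finset.sum_congr rfl fun a _ => ?_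
          rw [I.price_round k a]
          split_ifs <;> simp [g, hv]
      _ ≤ _ := by
          refine Finset.sum_le_sum fun b _ => mul_le_mul_of_nonneg_left ?_ (by positivity)
          have h1 : ∀ m, I.totalPrice v ((b, m) :: h) + 0 ≤
              I.pricePolicy.valueFrom k ((b, m) :: h) := fun m => by
            rw [add_zero]; exact ih _ (by simp; omega)
          obtain ⟨-, -, hav⟩ := I.pricePolicy_feasible h b (by omega)
          refine le_trans ?_ (I.probeValue_mono b (V := fun m =>
            I.totalPrice v ((b, m) :: h) + 0) (h1 _) fun a _ => h1 _)
          rw [I.probeValue_totalPrice v h b _ hav, add_zero]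
          refine add_le_add le_rfl (Finset.sum_le_sum fun a _ => ?_)
          have hk' : I.rounds - 1 - h.length = k := by omega
          obtain ⟨m, H⟩ := I.greedyList_spec (I.price (k * I.types + b)) b
          rw [pricePolicy, hk']
          by_cases ha : I.Available h a
          · rw [if_pos ha]
            by_cases hal : a ∈ I.greedyList (I.price (k * I.types + b)) b
            -- Two gains over the planned increment: filtering raises the reach probability, and the
            -- opportunity cost is the price at the start of the round's updates, which is at most
            -- the price the list was computed with.
            · refine mul_le_mul (mul_le_mul_of_nonneg_left
                (I.reachProb_le_filter b _ _ (by simpa using ha)) (I.prob_real_nonneg a b))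
                (sub_le_sub_left (I.price_mono a (Nat.le_add_right _ _)) _)
                (sub_nonneg.2 (H.cost_le a hal))
                (mul_nonneg (I.prob_real_nonneg a b) (I.reachProb_nonneg b _ a))
            · have : a ∉ (I.greedyList (I.price (k * I.types + b)) b).filter
                  fun a => decide (I.Available h a) := fun h2 => hal (List.mem_filter.1 h2).1
              simp [g, I.reachProb_eq_zero b hal, I.reachProb_eq_zero b this]
          · rw [if_neg ha, I.reachProb_eq_zero b (fun h2 => ha (by
              simpa using (List.mem_filter.1 h2).2))]
            simp

theorem le_expectedProfit_pricePolicy (I : Instance) :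
    ∑ a, I.startPrice a ≤ I.pricePolicy.expectedProfit := by
  have := I.le_valueFrom_pricePolicy I.rounds [] (by simp)
  rwa [I.totalPrice_nil] at this

end Instance

/-! ### Running times of programs -/

/-- Writing `v` to entry `i` of array `x`. -/
def Store.put (s : Store) (x i v : ℕ) : Store := Function.update s x (Function.update (s x) i v)

theorem Store.put_self (s : Store) (x i v : ℕ) : s.put x i v x i = v := by
  simp [Store.put]

theorem Store.put_of_ne (s : Store) (i v : ℕ) {x y : ℕ} (h : y ≠ x) : s.put x i v y = s y := by
  simp [Store.put, h]

theorem Store.put_of_ne_index (s : Store) (x v : ℕ) {i j : ℕ} (h : j ≠ i) :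
    s.put x i v x j = s x j := by
  simp [Store.put, h]

/-- All entries have at most `L` bits. -/
def Store.Bounded (L : ℕ) (s : Store) : Prop := ∀ x i, s x i < 2 ^ L

theorem Store.Bounded.put {L : ℕ} {s : Store} (hs : s.Bounded L) {x i v : ℕ} (hv : v < 2 ^ L) :
    (s.put x i v).Bounded L := by
  intro y j
  by_cases hy : y = x
  · subst hy
    by_cases hj : j = i
    · subst hj; rwa [s.put_self]
    · rw [s.put_of_ne_index y v hj]; exact hs _ _
  · rw [s.put_of_ne i v hy]; exact hs _ _

/-! ### Sizes and costs of expressions -/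

namespace Expr

/-- The value has at most `width * L` bits in a memory all of whose entries have at most `L`
bits. -/
def width : Expr → ℕ
  | const c => c.size + 1
  | cell _ _ => 1
  | add e f => e.width + f.width
  | sub e f => e.width + f.width
  | mul e f => e.width + f.width
  | div e f => e.width + f.width

/-- The cost is at most `weight * L` in a memory all of whose entries have at most `L` bits. -/
def weight : Expr → ℕ
  | const c => c.size + 1
  | cell _ i => i.weight + 1 + i.width + 1
  | add e f => e.weight + f.weight + 1 + e.width + f.width
  | sub e f => e.weight + f.weight + 1 + e.width + f.width
  | mul e f => e.weight + f.weight + 1 + e.width + f.width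
  | div e f => e.weight + f.weight + 1 + e.width + f.width

theorem one_le_width (e : Expr) : 1 ≤ e.width := by
  induction e <;> simp only [width] <;> omega

theorem val_lt {L : ℕ} (hL : 1 ≤ L) {s : Store} (hs : s.Bounded L) (e : Expr) :
    e.val s < 2 ^ (e.width * L) := by
  have mono : ∀ e f : Expr, 2 ^ (e.width * L) ≤ 2 ^ ((e.width + f.width) * L) := fun e f =>
    Nat.pow_le_pow_right two_pos (Nat.mul_le_mul_right _ (Nat.le_add_right _ _))
  induction e with
  | const c =>
    exact (Nat.lt_size_self c).trans_le (Nat.pow_le_pow_right two_pos (by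
      simp only [width]; nlinarith))
  | cell x i => simpa [width, val] using hs x _
  | add e f he hf =>
    simp only [width, val, add_mul, pow_add]
    -- A sum is at most the product once both bounds are at least 2; this is why every width is
    -- positive.
    have h1 : 2 ≤ 2 ^ (e.width * L) := by
      calc 2 = 2 ^ 1 := rfl
        _ ≤ _ := Nat.pow_le_pow_right two_pos (Nat.mul_pos (one_le_width e) hL)
    have h2 : 2 ≤ 2 ^ (f.width * L) := by
      calc 2 = 2 ^ 1 := rfl
        _ ≤ _ := Nat.pow_le_pow_right two_pos (Nat.mul_pos (one_le_width f) hL)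
    nlinarith
  | sub e f he hf => exact ((Nat.sub_le _ _).trans_lt he).trans_le (mono e f)
  | mul e f he hf =>
    simp only [width, val, add_mul, pow_add]
    exact Nat.mul_lt_mul'' he hf
  | div e f he hf => exact ((Nat.div_le_self _ _).trans_lt he).trans_le (mono e f)

theorem size_val_le {L : ℕ} (hL : 1 ≤ L) {s : Store} (hs : s.Bounded L) (e : Expr) :
    (e.val s).size ≤ e.width * L := Nat.size_le.2 (val_lt hL hs e)

theorem cost_le {L : ℕ} (hL : 1 ≤ L) {s : Store} (hs : s.Bounded L) (e : Expr) :
    e.cost s ≤ e.weight * L := by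
  induction e with
  | const c => simp only [cost, weight]; nlinarith
  | cell x i hi =>
    have h1 := size_val_le hL hs i
    have h2 : (s x (i.val s)).size ≤ L := Nat.size_le.2 (hs _ _)
    simp only [cost, weight, add_mul, one_mul]
    omega
  | add e f he hf | sub e f he hf | mul e f he hf | div e f he hf =>
    have h1 := size_val_le hL hs e
    have h2 := size_val_le hL hs f
    simp only [cost, weight, add_mul, one_mul]
    omega

end Expr

/-! ### A program logic with bounds for time and memory -/

namespace Prog

/-- A bound for the running time if loops are executed at most `M` times and all entries of the
memory have at most `L` bits. -/
def timeBound {R : Type*} [CommSemiring R] (M L : R) : Prog → R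
  | skip => 1
  | assign _ i e => ((i.weight + e.weight + 1 + i.width + e.width : ℕ) : R) * L
  | seq c d => timeBound M L c + timeBound M L d
  | cond e c d => ((e.weight + 1 : ℕ) : R) * L + timeBound M L c + timeBound M L d
  | loop e c => (M + 1) * (((e.weight + 1 : ℕ) : R) * L + timeBound M L c)

/-- Applied to evaluation, this identifies the time bound for an instance with the value of a single
polynomial. -/
theorem map_timeBound {R S : Type*} [CommSemiring R] [CommSemiring S] (f : R →+* S) (M L : R)
    (c : Prog) : f (timeBound M L c) = timeBound (f M) (f L) c := by
  induction c <;> simp_all [timeBound]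

/-- The arrays that a program may write to. -/
def writes : Prog → List ℕ
  | skip => []
  | assign x _ _ => [x]
  | seq c d => writes c ++ writes d
  | cond _ c d => writes c ++ writes d
  | loop _ c => writes c

/-- Started in memory `s`, the program halts within the time bound for `M` and `L` in a memory
that satisfies `Q`, provided that all entries of `s` have at most `L` bits. -/
def Runs (M L : ℕ) (c : Prog) (s : Store) (Q : Store → Prop) : Prop :=
  s.Bounded L → ∃ s' t, Exec c s s' t ∧ t ≤ timeBound M L c ∧ s'.Bounded L ∧
    (∀ y, y ∉ writes c → s' y = s y) ∧ Q s'

theorem Runs.mono {M L : ℕ} {c : Prog} {s : Store} {Q Q' : Store → Prop} (h : Runs M L c s Q)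
    (hQ : ∀ s', s'.Bounded L → (∀ y, y ∉ writes c → s' y = s y) → Q s' → Q' s') :
    Runs M L c s Q' := fun hs =>
  let ⟨s', t, h1, h2, h3, h4, h5⟩ := h hs
  ⟨s', t, h1, h2, h3, h4, hQ s' h3 h4 h5⟩

theorem runs_skip {M L : ℕ} {s : Store} {Q : Store → Prop} (h : Q s) : Runs M L skip s Q :=
  fun hs => ⟨s, 1, Exec.skip s, le_rfl, hs, fun _ _ => rfl, h⟩

theorem runs_assign {M L : ℕ} (hL : 1 ≤ L) {x : ℕ} {i e : Expr} {s : Store} {Q : Store → Prop}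
    (k v : ℕ) (hk : i.val s = k) (hv : e.val s = v) (hvL : v < 2 ^ L) (h : Q (s.put x k v)) :
    Runs M L (assign x i e) s Q := by
  intro hs
  subst hk hv
  refine ⟨_, _, Exec.assign x i e s, ?_, hs.put hvL, fun y hy => ?_, h⟩
  · have h1 := Expr.cost_le hL hs i
    have h2 := Expr.cost_le hL hs e
    have h3 := Expr.size_val_le hL hs i
    have h4 := Expr.size_val_le hL hs e
    simp only [timeBound, Nat.cast_id, add_mul, one_mul]
    omega
  · exact s.put_of_ne _ _ (by simpa [writes] using hy)

theorem Runs.seq {M L : ℕ} {c d : Prog} {s : Store} {Q Q' : Store → Prop} (h : Runs M L c s Q)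
    (h' : ∀ s', s'.Bounded L → (∀ y, y ∉ writes c → s' y = s y) → Q s' → Runs M L d s' Q') :
    Runs M L (seq c d) s Q' := by
  intro hs
  obtain ⟨s₁, t₁, h1, h2, h3, h4, h5⟩ := h hs
  obtain ⟨s₂, t₂, k1, k2, k3, k4, k5⟩ := h' s₁ h3 h4 h5 h3
  refine ⟨s₂, _, Exec.seq h1 k1, add_le_add h2 k2, k3, fun y hy => ?_, k5⟩
  simp only [writes, List.mem_append, not_or] at hy
  rw [k4 y hy.2, h4 y hy.1]

theorem runs_seq_assign {M L : ℕ} (hL : 1 ≤ L) {x : ℕ} {i e : Expr} {d : Prog} {s : Store}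
    {Q : Store → Prop} (k v : ℕ) (hk : i.val s = k) (hv : e.val s = v) (hvL : v < 2 ^ L)
    (h : Runs M L d (s.put x k v) Q) : Runs M L (seq (assign x i e) d) s Q :=
  (runs_assign hL (Q := fun s' => s' = s.put x k v) k v hk hv hvL rfl).seq
    fun _ _ _ hs' => hs' ▸ h

theorem runs_cond {M L : ℕ} (hL : 1 ≤ L) {e : Expr} {c d : Prog} {s : Store} {Q : Store → Prop}
    (h1 : e.val s ≠ 0 → Runs M L c s Q) (h2 : e.val s = 0 → Runs M L d s Q) :
    Runs M L (cond e c d) s Q := by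
  intro hs
  have hc := Expr.cost_le hL hs e
  by_cases he : e.val s = 0
  · obtain ⟨s', t, k1, k2, k3, k4, k5⟩ := h2 he hs
    refine ⟨s', _, Exec.cond_false he k1, ?_, k3, fun y hy => k4 y ?_, k5⟩
    · simp only [timeBound, Nat.cast_id, add_mul, one_mul]; omega
    · simp only [writes, List.mem_append, not_or] at hy; exact hy.2
  · obtain ⟨s', t, k1, k2, k3, k4, k5⟩ := h1 he hs
    refine ⟨s', _, Exec.cond_true he k1, ?_, k3, fun y hy => k4 y ?_, k5⟩
    · simp only [timeBound, Nat.cast_id, add_mul, one_mul]; omega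
    · simp only [writes, List.mem_append, not_or] at hy; exact hy.1

/-- The invariant is indexed by the number of completed iterations and determines the test, so the
count is exactly `n`. The extra summand in `M + 1` pays for the final failing test. -/
theorem runs_loop {M L : ℕ} (hL : 1 ≤ L) {e : Expr} {c : Prog} {s : Store} {Q : Store → Prop}
    {n : ℕ} (hM : n ≤ M) (P : ℕ → Store → Prop) (h0 : P 0 s)
    (he : ∀ k s', P k s' → (e.val s' = 0 ↔ k = n))
    (hstep : ∀ k < n, ∀ s', s'.Bounded L → (∀ y, y ∉ writes c → s' y = s y) → P k s' →
      Runs M L c s' (P (k + 1)))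
    (hQ : ∀ s', P n s' → Q s') : Runs M L (loop e c) s Q := by
  intro hs
  have key : ∀ m k s', k + m = n → s'.Bounded L → (∀ y, y ∉ writes c → s' y = s y) → P k s' →
      ∃ s'' t, Exec (loop e c) s' s'' t ∧
        t ≤ (m + 1) * ((e.weight + 1) * L + timeBound M L c) ∧ s''.Bounded L ∧
        (∀ y, y ∉ writes c → s'' y = s y) ∧ P n s'' := by
    intro m
    induction m with
    | zero =>
      intro k s' hk hs' hfr hP
      have hc := Expr.cost_le hL hs' e
      obtain rfl : k = n := by omega
      refine ⟨s', _, Exec.loop_false ((he k s' hP).2 rfl), ?_, hs', hfr, hP⟩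
      simp only [add_mul, one_mul, zero_add]
      omega
    | succ m ih =>
      intro k s' hk hs' hfr hP
      have hc := Expr.cost_le hL hs' e
      obtain ⟨s₁, t₁, k1, k2, k3, k4, k5⟩ := hstep k (by omega) s' hs' hfr hP hs'
      obtain ⟨s₂, t₂, l1, l2, l3, l4, l5⟩ := ih (k + 1) s₁ (by omega) k3
        (fun y hy => (k4 y hy).trans (hfr y hy)) k5
      refine ⟨s₂, _, Exec.loop_true (fun h => ?_) k1 l1, ?_, l3, l4, l5⟩
      · have := (he k s' hP).1 h
        omega
      · simp only [add_mul, one_mul] at l2 ⊢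
        omega
  obtain ⟨s', t, k1, k2, k3, k4, k5⟩ := key n 0 s (by omega) hs (fun _ _ => rfl) h0
  refine ⟨s', t, k1, k2.trans ?_, k3, k4, hQ s' k5⟩
  simp only [timeBound, Nat.cast_id]
  exact Nat.mul_le_mul_right _ (by omega)

/-- Executing `c` for all values of `x` below `e`. -/
def forLoop (x : ℕ) (e : Expr) (c : Prog) : Prog :=
  seq (assign x (.const 0) (.const 0))
    (loop (.sub e (.cell x (.const 0)))
      (seq c (assign x (.const 0) (.add (.cell x (.const 0)) (.const 1)))))

/-- The limit `e` is evaluated again before each iteration; the frame condition is what keeps its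
value at `n`. The invariant has to survive the increment of the counter, hence the `put` in its
conclusion. -/
theorem runs_forLoop {M L : ℕ} (hL : 1 ≤ L) {x : ℕ} {e : Expr} {c : Prog} {s : Store}
    {Q : Store → Prop} {n : ℕ} (hM : n ≤ M) (hnL : n < 2 ^ L) (Inv : ℕ → Store → Prop)
    (hx : x ∉ writes c)
    (he : ∀ s' : Store, (∀ y, y ∉ x :: writes c → s' y = s y) → e.val s' = n)
    (h0 : Inv 0 (s.put x 0 0))
    (hstep : ∀ k < n, ∀ s' : Store, s'.Bounded L → (∀ y, y ∉ x :: writes c → s' y = s y) →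
      s' x 0 = k → Inv k s' → Runs M L c s' fun s'' => Inv (k + 1) (s''.put x 0 (k + 1)))
    (hQ : ∀ s' : Store, (∀ y, y ∉ x :: writes c → s' y = s y) → Inv n s' → Q s') :
    Runs M L (forLoop x e c) s Q := by
  refine runs_seq_assign hL 0 0 rfl rfl (by positivity) ?_
  refine runs_loop hL hM (fun k s' => k ≤ n ∧ (∀ y, y ∉ x :: writes c → s' y = s y) ∧
    s' x 0 = k ∧ Inv k s') ⟨Nat.zero_le _, fun y hy => ?_, s.put_self _ _ _, h0⟩ ?_ ?_ ?_
  · exact s.put_of_ne _ _ (by simp at hy; tauto)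
  · rintro k s' ⟨h1, h2, h3, -⟩
    simp only [Expr.val, he s' h2, h3]
    omega
  · rintro k hk s' hs' - ⟨h1, h2, h3, h4⟩
    refine (hstep k hk s' hs' h2 h3 h4).seq fun s₁ hs₁ hfr h5 => ?_
    have hk1 : s₁ x 0 = k := by rw [hfr x hx, h3]
    refine runs_assign hL 0 (k + 1) rfl (by simp [Expr.val, hk1]) (by omega)
      ⟨hk, fun y hy => ?_, s₁.put_self _ _ _, h5⟩
    have hy' : y ≠ x ∧ y ∉ writes c := by simpa using hy
    rw [s₁.put_of_ne _ _ hy'.1, hfr y hy'.2, h2 y hy]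
  · rintro s' ⟨-, h2, -, h4⟩
    exact hQ s' h2 h4

end Prog

/-! ### The memory at the start of a decision -/

namespace Instance

theorem rows_eq_ofFn (I : Instance) (f : Fin I.items → Fin I.types → ℕ) :
    I.rows f = List.ofFn fun k : Fin (I.items * I.types) => f k.divNat k.modNat := by
  rw [List.ofFn_mul, rows, List.flatMap, List.ofFn_eq_map]
  congr 1
  refine List.map_congr_left fun a _ => ?_
  rw [List.ofFn_eq_map]
  refine List.map_congr_left fun b _ => ?_
  have hb := b.2
  have hpos : 0 < I.types := b.pos
  congr 1
  · apply Fin.ext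
    simp [Fin.divNat, Nat.add_div hpos, Nat.div_eq_of_lt hb, Nat.mod_eq_of_lt hb,
      Nat.mul_div_cancel _ hpos, hb]
  · apply Fin.ext
    simp [Fin.modNat, Nat.mod_eq_of_lt hb]

theorem getD_rows (I : Instance) (f : Fin I.items → Fin I.types → ℕ) (a : Fin I.items)
    (b : Fin I.types) : (I.rows f).getD (a * I.types + b) 0 = f a b := by
  have hb := b.2
  have hpos : 0 < I.types := b.pos
  have hlt : a.val * I.types + b < I.items * I.types := by
    have := Nat.mul_le_mul_right I.types (Nat.succ_le_of_lt a.2)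
    rw [Nat.succ_mul] at this
    omega
  rw [I.rows_eq_ofFn, List.getD_eq_getElem _ _ (by simpa using hlt), List.getElem_ofFn]
  congr 1
  · apply Fin.ext
    simp [Fin.divNat, Nat.add_div hpos, Nat.div_eq_of_lt hb, Nat.mod_eq_of_lt hb,
      Nat.mul_div_cancel _ hpos, hb]
  · apply Fin.ext
    simp [Fin.modNat, Nat.mod_eq_of_lt hb]

theorem length_le_size (I : Instance) {l : List ℕ} (hl : l ∈ I.encode) : l.length ≤ I.size := by
  have h1 : l.length ≤ (l.map fun k => k.size + 1).sum := by
    clear hl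
    induction l with
    | nil => simp
    | cons k l ih => simp; omega
  have h2 : (l.map fun k => k.size + 1).sum ≤
      (I.encode.map fun l => (l.map fun k => k.size + 1).sum).sum :=
    List.single_le_sum (by simp) _ (List.mem_map.2 ⟨l, hl, rfl⟩)
  rw [size]
  omega

theorem lt_two_pow_size (I : Instance) {l : List ℕ} (hl : l ∈ I.encode) {k : ℕ} (hk : k ∈ l) :
    k < 2 ^ I.size := by
  have h1 : k.size + 1 ≤ (l.map fun k => k.size + 1).sum :=
    List.single_le_sum (by simp) _ (List.mem_map.2 ⟨k, hk, rfl⟩)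
  have h2 : (l.map fun k => k.size + 1).sum ≤
      (I.encode.map fun l => (l.map fun k => k.size + 1).sum).sum :=
    List.single_le_sum (by simp) _ (List.mem_map.2 ⟨l, hl, rfl⟩)
  rw [← Nat.size_le, size]
  omega

theorem rounds_le_size (I : Instance) : I.rounds ≤ I.size := Nat.le_add_right _ _

theorem types_le_size (I : Instance) : I.types ≤ I.size := by
  simpa using I.length_le_size (l := List.ofFn I.mult) (by simp [encode])

/-- A buyer type is needed: without types the matrices are empty, and the number of items is only
recorded in binary. -/
theorem items_le_size (I : Instance) (b : Fin I.types) : I.items ≤ I.size := by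
  have h := I.length_le_size (l := I.rows fun a b => (I.prob a b).den) (by simp [encode])
  rw [I.rows_eq_ofFn, List.length_ofFn] at h
  exact (Nat.le_mul_of_pos_right _ b.pos).trans h

/-- What the memory contains after the input has been read. -/
structure Loaded (I : Instance) (h : I.History) (b : Fin I.types) (s : Store) : Prop where
  items : s 0 0 = I.items
  types : s 0 1 = I.types
  rounds : s 0 2 = I.rounds
  mult : ∀ c : Fin I.types, s 1 c = I.mult c
  timeout : ∀ c : Fin I.types, s 2 c = I.timeout c
  probNum : ∀ a (c : Fin I.types), s 3 (a.val * I.types + c) = (I.prob a c).num.toNat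
  probDen : ∀ a (c : Fin I.types), s 4 (a.val * I.types + c) = (I.prob a c).den
  profitNum : ∀ a (c : Fin I.types), s 5 (a.val * I.types + c) = (I.profit a c).num.toNat
  profitDen : ∀ a (c : Fin I.types), s 6 (a.val * I.types + c) = (I.profit a c).den
  length : s 7 1 = h.length
  type : s 7 2 = b
  past : ∀ i (hi : i < h.length), s 10 i = h[i].2.elim 0 fun a => a.val + 1

theorem Loaded.congr {I : Instance} {h : I.History} {b : Fin I.types} {s s' : Store}
    (hs : I.Loaded h b s) (hss : ∀ y ≤ 10, s' y = s y) : I.Loaded h b s' := by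
  constructor
  · rw [hss 0 (by norm_num)]; exact hs.items
  · rw [hss 0 (by norm_num)]; exact hs.types
  · rw [hss 0 (by norm_num)]; exact hs.rounds
  · rw [hss 1 (by norm_num)]; exact hs.mult
  · rw [hss 2 (by norm_num)]; exact hs.timeout
  · rw [hss 3 (by norm_num)]; exact hs.probNum
  · rw [hss 4 (by norm_num)]; exact hs.probDen
  · rw [hss 5 (by norm_num)]; exact hs.profitNum
  · rw [hss 6 (by norm_num)]; exact hs.profitDen
  · rw [hss 7 (by norm_num)]; exact hs.length
  · rw [hss 7 (by norm_num)]; exact hs.type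
  · rw [hss 10 (by norm_num)]; exact hs.past

theorem loaded_init (I : Instance) {m : ℕ} (coins : Fin m → Bool) (h : I.History)
    (b : Fin I.types) : I.Loaded h b (Store.init (I.decisionInput coins h b)) := by
  constructor
  · rfl
  · rfl
  · rfl
  · intro c; simp [Store.init, decisionInput, encode]
  · intro c; simp [Store.init, decisionInput, encode]
  · intro a c; exact I.getD_rows _ a c
  · intro a c; exact I.getD_rows _ a c
  · intro a c; exact I.getD_rows _ a c
  · intro a c; exact I.getD_rows _ a c
  · rfl
  · rfl
  · intro i hi; simp [Store.init, decisionInput, encode, hi]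

theorem init_of_ge (I : Instance) {m : ℕ} (coins : Fin m → Bool) (h : I.History)
    (b : Fin I.types) {x : ℕ} (hx : 11 ≤ x) (i : ℕ) :
    Store.init (I.decisionInput coins h b) x i = 0 := by
  have : (I.decisionInput coins h b).length ≤ x := by simpa [decisionInput, encode] using hx
  simp [Store.init, List.getElem?_eq_none this]

theorem bounded_init (I : Instance) {m L : ℕ} (coins : Fin m → Bool) (h : I.History)
    (b : Fin I.types) (hh : h.length < I.rounds) (hm : m < 2 ^ L) (hL : I.size + 1 ≤ L) :
    (Store.init (I.decisionInput coins h b)).Bounded L := by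
  have hsize : I.size < 2 ^ L :=
    Nat.lt_two_pow_self.trans_le (Nat.pow_le_pow_right two_pos (by omega))
  have key : ∀ l ∈ I.decisionInput coins h b, ∀ k ∈ l, k < 2 ^ L := by
    intro l hl k hk
    rw [decisionInput, List.mem_append] at hl
    rcases hl with hl | hl
    · exact (I.lt_two_pow_size hl hk).trans_le (Nat.pow_le_pow_right two_pos (by omega))
    · have hr := I.rounds_le_size
      have ht := I.types_le_size
      simp only [List.mem_cons, List.not_mem_nil, or_false] at hl
      rcases hl with rfl | rfl | rfl | rfl
      · simp only [List.mem_cons, List.not_mem_nil, or_false] at hk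
        rcases hk with rfl | rfl | rfl
        · exact hm
        · omega
        · have := b.2
          omega
      · simp only [List.mem_ofFn] at hk
        obtain ⟨i, rfl⟩ := hk
        have : 2 ≤ 2 ^ L := by
          calc 2 = 2 ^ 1 := rfl
            _ ≤ _ := Nat.pow_le_pow_right two_pos (by omega)
        have := Bool.toNat_le (coins i)
        omega
      · obtain ⟨r, -, rfl⟩ := List.mem_map.1 hk
        have := r.1.2
        omega
      · obtain ⟨r, -, rfl⟩ := List.mem_map.1 hk
        have hi := I.items_le_size b
        rcases r with ⟨c, _ | a⟩
        · simp
        · have := a.2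
          simp only [Option.elim]
          omega
  intro x i
  rw [Store.init]
  by_cases hx : x < (I.decisionInput coins h b).length
  · rw [List.getD_eq_getElem _ _ hx]
    by_cases hi : i < (I.decisionInput coins h b)[x].length
    · rw [List.getD_eq_getElem _ _ hi]
      exact key _ (List.getElem_mem _) _ (List.getElem_mem _)
    · rw [List.getD_eq_default _ _ (by omega)]
      positivity
  · rw [List.getD_eq_default _ [] (by omega)]
    simp

/-! ### Numerators and denominators of the input -/

theorem probNum_cast (I : Instance) (a : Fin I.items) (c : Fin I.types) :
    (((I.prob a c).num.toNat : ℕ) : ℝ) = I.prob a c * ((I.prob a c).den : ℝ) := by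
  have h1 : (((I.prob a c).num.toNat : ℕ) : ℤ) = (I.prob a c).num :=
    Int.toNat_of_nonneg (Rat.num_nonneg.2 (I.prob_pos a c).le)
  have h2 := Rat.mul_den_eq_num (I.prob a c)
  rw [← h1] at h2
  exact_mod_cast h2.symm

theorem profitNum_cast (I : Instance) (a : Fin I.items) (c : Fin I.types) :
    (((I.profit a c).num.toNat : ℕ) : ℝ) = I.profit a c * ((I.profit a c).den : ℝ) := by
  have h1 : (((I.profit a c).num.toNat : ℕ) : ℤ) = (I.profit a c).num :=
    Int.toNat_of_nonneg (Rat.num_nonneg.2 (I.profit_pos a c).le)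
  have h2 := Rat.mul_den_eq_num (I.profit a c)
  rw [← h1] at h2
  exact_mod_cast h2.symm

theorem mem_rows (I : Instance) (f : Fin I.items → Fin I.types → ℕ) (a : Fin I.items)
    (b : Fin I.types) : f a b ∈ I.rows f := by
  simp only [rows, List.mem_flatMap, List.mem_finRange, true_and, List.mem_map]
  exact ⟨a, b, rfl⟩

theorem probNum_lt (I : Instance) (a : Fin I.items) (c : Fin I.types) :
    (I.prob a c).num.toNat < 2 ^ I.size :=
  I.lt_two_pow_size (by simp [encode]) (I.mem_rows (fun a b => (I.prob a b).num.toNat) a c)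

theorem probDen_lt (I : Instance) (a : Fin I.items) (c : Fin I.types) :
    (I.prob a c).den < 2 ^ I.size :=
  I.lt_two_pow_size (by simp [encode]) (I.mem_rows (fun a b => (I.prob a b).den) a c)

theorem profitNum_lt (I : Instance) (a : Fin I.items) (c : Fin I.types) :
    (I.profit a c).num.toNat < 2 ^ I.size :=
  I.lt_two_pow_size (by simp [encode]) (I.mem_rows (fun a b => (I.profit a b).num.toNat) a c)

theorem profitDen_lt (I : Instance) (a : Fin I.items) (c : Fin I.types) :
    (I.profit a c).den < 2 ^ I.size :=
  I.lt_two_pow_size (by simp [encode]) (I.mem_rows (fun a b => (I.profit a b).den) a c)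

theorem mult_lt (I : Instance) (c : Fin I.types) : I.mult c < 2 ^ I.size :=
  I.lt_two_pow_size (l := List.ofFn I.mult) (by simp [encode]) (by simp)

theorem rounds_lt (I : Instance) : I.rounds < 2 ^ I.size :=
  I.lt_two_pow_size (l := [I.items, I.types, I.rounds]) (by simp [encode]) (by simp)

end Instance

/-! ### The program

Arrays `0` to `10` hold the input. The price of item `a` is the quotient of the entries `a` of the
arrays `11` and `12`; entry `a` of array `13` is the number of the last step whose list contains
`a`; entry `a + 1` of array `14` is nonzero if `a` has been matched; array `15` contains the current
list in reverse order. The registers (entries `0` of further arrays) are: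
`16` counts steps, `17` is the number of steps, `18` is the buyer type of the step, `19` and `20` are
numerator and denominator of the value of the current list, `21` is its length, `22` and `23` are
counters, `24` is the best item (plus one, or `0`), `25` and `26` are numerator and denominator of
its surplus, `27` is the current item, `30` and `31` are numerator and denominator of the
probability of reaching the current item, `32` is the length of the output. -/

namespace Expr

/-- Entry `0` of array `x`. -/
def reg (x : ℕ) : Expr := cell x (const 0)

/-- The position of item `a` and the buyer type in register `18` in a matrix. -/
def entry (a : Expr) : Expr := add (mul a (cell 0 (const 1))) (reg 18)

/-- The numerator of the surplus of item `a`. -/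
def surplusNum (a : Expr) : Expr :=
  mul (cell 3 (entry a)) (sub (mul (mul (cell 5 (entry a)) (cell 12 a)) (reg 20))
    (mul (add (mul (cell 11 a) (reg 20)) (mul (reg 19) (cell 12 a))) (cell 6 (entry a))))

/-- The denominator of the surplus of item `a`. -/
def surplusDen (a : Expr) : Expr :=
  mul (mul (mul (cell 4 (entry a)) (cell 6 (entry a))) (cell 12 a)) (reg 20)

/-- Numerator of the probability that the buyer is of the current type and is matched to
item `a`. -/
def matchNum (a : Expr) : Expr :=
  mul (mul (cell 1 (reg 18)) (reg 30)) (cell 3 (entry a))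

/-- Denominator of the probability that the buyer is of the current type and is matched to
item `a`. -/
def matchDen (a : Expr) : Expr :=
  mul (mul (cell 0 (const 2)) (reg 31)) (cell 4 (entry a))

end Expr

namespace Prog

open Expr

/-- Finds the item of largest positive surplus outside of the current list. -/
def findBest : Prog :=
  forLoop 23 (cell 0 (const 0))
    -- The product is a conjunction: the item is not marked in this step, and its surplus exceeds
    -- the best one so far, by cross multiplication with truncated subtraction.
    (cond (mul (sub (add (reg 16) (const 1)) (cell 13 (reg 23)))
        (sub (mul (surplusNum (reg 23)) (reg 26)) (mul (reg 25) (surplusDen (reg 23)))))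
      (seq (assign 24 (const 0) (add (reg 23) (const 1)))
        (seq (assign 25 (const 0) (surplusNum (reg 23)))
          (assign 26 (const 0) (surplusDen (reg 23)))))
      skip)

/-- Puts the best item in front of the current list. -/
def insertBest : Prog :=
  -- The division is exact: the denominator of the surplus is a multiple of that of the value, so
  -- the sum of both needs no larger denominator.
  seq (assign 19 (const 0) (add (mul (reg 19) (div (reg 26) (reg 20))) (reg 25)))
    (seq (assign 20 (const 0) (reg 26))
      (seq (assign 13 (sub (reg 24) (const 1)) (add (reg 16) (const 1)))
        (seq (assign 15 (reg 21) (sub (reg 24) (const 1)))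
          (assign 21 (const 0) (add (reg 21) (const 1))))))

/-- Enlarges the current list by one item, if possible. -/
def greedyStep : Prog :=
  seq (assign 24 (const 0) (const 0))
    (seq (assign 25 (const 0) (const 0))
      (seq (assign 26 (const 0) (const 1))
        (seq findBest
          (cond (mul (reg 24) (sub (cell 2 (reg 18)) (reg 21))) insertBest skip))))

/-- Computes the greedy list for the buyer type in register `18`. -/
def greedyLoop : Prog := forLoop 22 (cell 0 (const 0)) greedyStep

/-- The item in the current list whose position is in register `22`. -/
def nextItem : Prog :=
  assign 27 (const 0) (cell 15 (sub (sub (reg 21) (const 1)) (reg 22)))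

/-- Updates the price of one item. -/
def priceStep : Prog :=
  seq nextItem
    (seq (assign 11 (reg 27)
        (add (mul (cell 11 (reg 27)) (mul (matchDen (reg 27)) (cell 6 (entry (reg 27)))))
          (mul (matchNum (reg 27))
            (sub (mul (cell 5 (entry (reg 27))) (cell 12 (reg 27)))
              (mul (cell 11 (reg 27)) (cell 6 (entry (reg 27))))))))
      (seq (assign 12 (reg 27)
          (mul (cell 12 (reg 27)) (mul (matchDen (reg 27)) (cell 6 (entry (reg 27))))))
        (seq (assign 30 (const 0)
            (mul (reg 30) (sub (cell 4 (entry (reg 27))) (cell 3 (entry (reg 27))))))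
          (assign 31 (const 0) (mul (reg 31) (cell 4 (entry (reg 27))))))))

/-- Updates the prices of the items in the current list. -/
def priceLoop : Prog := forLoop 22 (reg 21) priceStep

/-- One step of the computation of prices. -/
def mainStep : Prog :=
  seq (assign 18 (const 0)
      (sub (reg 16) (mul (div (reg 16) (cell 0 (const 1))) (cell 0 (const 1)))))
    (seq (assign 19 (const 0) (const 0))
      (seq (assign 20 (const 0) (const 1))
        (seq (assign 21 (const 0) (const 0))
          (seq greedyLoop
            (seq (assign 30 (const 0) (const 1))
              (seq (assign 31 (const 0) (const 1)) priceLoop))))))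

/-- Computes the list for the current buyer. -/
def mainLoop : Prog := forLoop 16 (reg 17) mainStep

/-- Initializes the denominators of the prices. -/
def initPrices : Prog :=
  forLoop 23 (cell 0 (const 0)) (assign 12 (reg 23) (const 1))

/-- Marks the items that have been matched. -/
def markMatched : Prog :=
  -- Entry `0` absorbs the unmatched buyers, which is why items are shifted by one.
  forLoop 23 (cell 7 (const 1)) (assign 14 (cell 10 (reg 23)) (const 1))

/-- Outputs the next item if it is available. -/
def outputStep : Prog :=
  seq nextItem
    (cond (cell 14 (add (reg 27) (const 1))) skip
      (seq (assign 1 (reg 32) (reg 27)) (assign 32 (const 0) (add (reg 32) (const 1)))))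

/-- Outputs the available items of the current list. -/
def outputLoop : Prog := forLoop 22 (reg 21) outputStep

/-- The program of the online algorithm. -/
def main : Prog :=
  seq initPrices
    (seq markMatched
      (seq (assign 17 (const 0)
          (add (add (mul (sub (sub (cell 0 (const 2)) (const 1)) (cell 7 (const 1)))
            (cell 0 (const 1))) (cell 7 (const 2))) (const 1)))
        (seq mainLoop
          (seq outputLoop (assign 0 (const 0) (reg 32))))))

end Prog

namespace Instance

/-! ### The search for the best item -/

/-- The entry `a` of the arrays `11` and `12` are numerator and denominator of `v a`, of at most `B`
bits. -/
def StoresPrices (I : Instance) (v : Fin I.items → ℝ) (B : ℕ) (s : Store) : Prop :=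
  ∀ a : Fin I.items, 0 < s 12 a ∧ s 11 a < 2 ^ B ∧ s 12 a < 2 ^ B ∧
    (s 11 a : ℝ) = v a * (s 12 a : ℝ)

/-- The memory during the search for the best item: the current list is `l` and its value
is `G`. -/
structure Searching (I : Instance) (v : Fin I.items → ℝ) (c : Fin I.types) (G : ℝ)
    (l : List (Fin I.items)) (j B Y : ℕ) (s : Store) : Prop where
  prices : I.StoresPrices v B s
  step : s 16 0 = j
  type : s 18 0 = c
  num_lt : s 19 0 < 2 ^ Y
  den_pos : 0 < s 20 0
  den_lt : s 20 0 < 2 ^ Y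
  value : (s 19 0 : ℝ) = G * (s 20 0 : ℝ)
  -- Marks are step numbers, so they need no clearing between steps: marks from earlier steps are
  -- smaller than `j + 1`.
  mark_le : ∀ a : Fin I.items, s 13 a ≤ j + 1
  mark_eq : ∀ a : Fin I.items, s 13 a = j + 1 ↔ a ∈ l

theorem Searching.congr {I : Instance} {v : Fin I.items → ℝ} {c : Fin I.types} {G : ℝ}
    {l : List (Fin I.items)} {j B Y : ℕ} {s s' : Store} (H : I.Searching v c G l j B Y s)
    (h11 : s' 11 = s 11) (h12 : s' 12 = s 12) (h13 : s' 13 = s 13) (h16 : s' 16 = s 16)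
    (h18 : s' 18 = s 18) (h19 : s' 19 = s 19) (h20 : s' 20 = s 20) :
    I.Searching v c G l j B Y s' := by
  constructor
  · intro a; rw [h11, h12]; exact H.prices a
  · rw [h16]; exact H.step
  · rw [h18]; exact H.type
  · rw [h19]; exact H.num_lt
  · rw [h20]; exact H.den_pos
  · rw [h20]; exact H.den_lt
  · rw [h19, h20]; exact H.value
  · rw [h13]; exact H.mark_le
  · rw [h13]; exact H.mark_eq

/-- The numerator of the surplus of item `a` in terms of the memory. -/
def storeSurplusNum (I : Instance) (c : Fin I.types) (s : Store) (a : Fin I.items) : ℕ :=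
  (I.prob a c).num.toNat * ((I.profit a c).num.toNat * s 12 a * s 20 0 -
    (s 11 a * s 20 0 + s 19 0 * s 12 a) * (I.profit a c).den)

/-- The denominator of the surplus of item `a` in terms of the memory. -/
def storeSurplusDen (I : Instance) (c : Fin I.types) (s : Store) (a : Fin I.items) : ℕ :=
  (I.prob a c).den * (I.profit a c).den * s 12 a * s 20 0

section
variable {I : Instance} {v : Fin I.items → ℝ} {c : Fin I.types} {G : ℝ}
  {l : List (Fin I.items)} {j B Y : ℕ} {s : Store}

/-- Truncated subtraction yields the positive part of the surplus. Nothing is lost, since only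
positive surpluses are ever chosen. -/
theorem Searching.surplusNum_eq (H : I.Searching v c G l j B Y s) (a : Fin I.items) :
    (I.storeSurplusNum c s a : ℝ) = max (I.surplus v c G a) 0 * I.storeSurplusDen c s a := by
  obtain ⟨-, -, -, hv⟩ := H.prices a
  have hsub : ∀ x y : ℕ, ((x - y : ℕ) : ℝ) = max ((x : ℝ) - y) 0 := by
    intro x y
    rcases le_total y x with h | h
    · rw [Nat.cast_sub h, max_eq_left]
      exact sub_nonneg.2 (by exact_mod_cast h)
    · rw [Nat.sub_eq_zero_of_le h, max_eq_right]
      · simp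
      · exact sub_nonpos.2 (by exact_mod_cast h)
  rw [storeSurplusNum, Nat.cast_mul, hsub, mul_max_of_nonneg _ _ (Nat.cast_nonneg _),
    max_mul_of_nonneg _ _ (Nat.cast_nonneg _), mul_zero, zero_mul]
  congr 1
  simp only [storeSurplusDen, surplus]
  push_cast
  rw [I.probNum_cast, I.profitNum_cast, hv, H.value]
  ring

theorem Searching.surplusDen_pos (H : I.Searching v c G l j B Y s) (a : Fin I.items) :
    0 < I.storeSurplusDen c s a := by
  have h1 := (I.prob a c).den_pos
  have h2 := (I.profit a c).den_pos
  have h3 := (H.prices a).1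
  have h4 := H.den_pos
  simp only [storeSurplusDen]
  positivity

theorem Searching.surplusNum_lt (H : I.Searching v c G l j B Y s) (a : Fin I.items) :
    I.storeSurplusNum c s a < 2 ^ (2 * I.size + B + Y) := by
  calc I.storeSurplusNum c s a
      ≤ (I.prob a c).num.toNat * ((I.profit a c).num.toNat * s 12 a * s 20 0) :=
        Nat.mul_le_mul_left _ (Nat.sub_le _ _)
    _ < 2 ^ I.size * (2 ^ I.size * 2 ^ B * 2 ^ Y) :=
        Nat.mul_lt_mul'' (I.probNum_lt a c) (Nat.mul_lt_mul''
          (Nat.mul_lt_mul'' (I.profitNum_lt a c) (H.prices a).2.2.1) H.den_lt)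
    _ = _ := by ring

theorem Searching.surplusDen_lt (H : I.Searching v c G l j B Y s) (a : Fin I.items) :
    I.storeSurplusDen c s a < 2 ^ (2 * I.size + B + Y) := by
  calc I.storeSurplusDen c s a < 2 ^ I.size * 2 ^ I.size * 2 ^ B * 2 ^ Y :=
        Nat.mul_lt_mul'' (Nat.mul_lt_mul'' (Nat.mul_lt_mul'' (I.probDen_lt a c)
          (I.profitDen_lt a c)) (H.prices a).2.2.1) H.den_lt
    _ = _ := by ring

theorem storeSurplusNum_congr {s s' : Store} (h11 : s' 11 = s 11) (h12 : s' 12 = s 12)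
    (h19 : s' 19 = s 19) (h20 : s' 20 = s 20) (a : Fin I.items) :
    I.storeSurplusNum c s' a = I.storeSurplusNum c s a := by
  simp only [storeSurplusNum, h11, h12, h19, h20]

theorem storeSurplusDen_congr {s s' : Store} (h12 : s' 12 = s 12) (h20 : s' 20 = s 20)
    (a : Fin I.items) : I.storeSurplusDen c s' a = I.storeSurplusDen c s a := by
  simp only [storeSurplusDen, h12, h20]

theorem val_surplusNum {h : I.History} {b : Fin I.types} (hs : I.Loaded h b s)
    (hc : s 18 0 = c) {x : ℕ} {a : Fin I.items} (ha : s x 0 = a) :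
    (Expr.surplusNum (Expr.reg x)).val s = I.storeSurplusNum c s a := by
  simp only [Expr.surplusNum, Expr.entry, Expr.reg, Expr.val, hc, ha, hs.types, hs.probNum,
    hs.profitNum, hs.profitDen, storeSurplusNum]

theorem val_surplusDen {h : I.History} {b : Fin I.types} (hs : I.Loaded h b s)
    (hc : s 18 0 = c) {x : ℕ} {a : Fin I.items} (ha : s x 0 = a) :
    (Expr.surplusDen (Expr.reg x)).val s = I.storeSurplusDen c s a := by
  simp only [Expr.surplusDen, Expr.entry, Expr.reg, Expr.val, hc, ha, hs.types, hs.probDen,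
    hs.profitDen, storeSurplusDen]

/-- The best item and its surplus are in the registers `24` to `26`. -/
def StoresBest (I : Instance) (c : Fin I.types) (s : Store) (o : Option (Fin I.items))
    (s' : Store) : Prop :=
  s' 24 0 = o.elim 0 (fun a => a.val + 1) ∧ s' 25 0 = o.elim 0 (I.storeSurplusNum c s) ∧
    s' 26 0 = o.elim 1 (I.storeSurplusDen c s)

theorem Searching.best_eq (H : I.Searching v c G l j B Y s) {s' : Store} {k : ℕ}
    (hb : I.StoresBest c s (I.bestItem v c G l k).1 s') :
    (s' 25 0 : ℝ) = (I.bestItem v c G l k).2 * (s' 26 0 : ℝ) ∧ 0 < s' 26 0 := by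
  obtain ⟨-, h2, h3⟩ := hb
  rcases ho : (I.bestItem v c G l k).1 with _ | a
  · rw [ho] at h2 h3
    simp only [Option.elim] at h2 h3
    simp [h2, h3, I.bestItem_none v c G l k ho]
  · obtain ⟨-, hm, hpos⟩ := I.bestItem_some v c G l k a ho
    rw [ho] at h2 h3
    simp only [Option.elim] at h2 h3
    rw [h2, h3, hm, H.surplusNum_eq a, max_eq_left hpos.le]
    exact ⟨rfl, H.surplusDen_pos a⟩

theorem runs_findBest {M L : ℕ} {h : I.History} {b : Fin I.types} (hs : I.Loaded h b s)
    (H : I.Searching v c G l j B Y s) (h24 : s 24 0 = 0) (h25 : s 25 0 = 0) (h26 : s 26 0 = 1)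
    (hM : I.size ≤ M) (hL : I.size + 1 ≤ L) (hBY : 2 * I.size + B + Y ≤ L) :
    Prog.Runs M L Prog.findBest s
      (I.StoresBest c s (I.bestItem v c G l I.items).1) := by
  have hA := I.items_le_size c
  have hsize : I.size < 2 ^ L :=
    Nat.lt_two_pow_self.trans_le (Nat.pow_le_pow_right two_pos (by omega))
  have hpow : 2 ^ (2 * I.size + B + Y) ≤ 2 ^ L := Nat.pow_le_pow_right two_pos hBY
  refine Prog.runs_forLoop (by omega) (n := I.items) (hA.trans hM) (hA.trans_lt hsize)
    (fun k => I.StoresBest c s (I.bestItem v c G l k).1) (by decide) ?_ ?_ ?_ ?_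
  · intro s' hs'
    simp only [Expr.val, hs' 0 (by decide), hs.items]
  · simp [StoresBest, bestItem, Store.put_of_ne, h24, h25, h26]
  · intro k hk s' hbd hfr hk0 hinv
    have hs' : I.Loaded h b s' := hs.congr fun y hy => hfr y (by
      simp [Prog.writes]; omega)
    have f11 := hfr 11 (by decide)
    have f12 := hfr 12 (by decide)
    have f13 := hfr 13 (by decide)
    have f16 := hfr 16 (by decide)
    have f18 := hfr 18 (by decide)
    have f19 := hfr 19 (by decide)
    have f20 := hfr 20 (by decide)
    have H' := H.congr f11 f12 f13 f16 f18 f19 f20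
    set a : Fin I.items := ⟨k, hk⟩ with ha
    have hk0' : s' 23 0 = a := hk0
    obtain ⟨hbest, hbpos⟩ := H.best_eq hinv
    have hnum : I.storeSurplusNum c s' a = I.storeSurplusNum c s a :=
      storeSurplusNum_congr f11 f12 f19 f20 a
    have hden : I.storeSurplusDen c s' a = I.storeSurplusDen c s a :=
      storeSurplusDen_congr f12 f20 a
    have hcond : (Expr.mul (Expr.sub (Expr.add (Expr.reg 16) (Expr.const 1))
        (Expr.cell 13 (Expr.reg 23))) (Expr.sub (Expr.mul (Expr.surplusNum (Expr.reg 23))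
          (Expr.reg 26)) (Expr.mul (Expr.reg 25) (Expr.surplusDen (Expr.reg 23))))).val s' ≠ 0 ↔
        (a ∉ l ∧ (I.bestItem v c G l k).2 < I.surplus v c G a) := by
      have e : ∀ x, (Expr.reg x).val s' = s' x 0 := fun x => rfl
      simp only [Expr.val, val_surplusNum hs' H'.type hk0', val_surplusDen hs' H'.type hk0', e,
        hk0', hnum, hden, H'.step]
      rw [mul_ne_zero_iff, ← H'.mark_eq a]
      refine and_congr ?_ ?_
      · have := H'.mark_le a
        omega
      -- Both fractions are brought to a common positive denominator. The positive part is harmless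
      -- because the current best surplus is nonnegative.
      · rw [Nat.sub_ne_zero_iff_lt, ← Nat.cast_lt (α := ℝ)]
        push_cast
        rw [hbest, H.surplusNum_eq a]
        have hp : (0 : ℝ) < s' 26 0 * I.storeSurplusDen c s a := by
          have := H.surplusDen_pos a
          positivity
        have h0 := I.bestItem_nonneg v c G l k
        rw [show (I.bestItem v c G l k).2 * (s' 26 0 : ℝ) * (I.storeSurplusDen c s a : ℝ) =
          (I.bestItem v c G l k).2 * (s' 26 0 * I.storeSurplusDen c s a) by ring,
          show max (I.surplus v c G a) 0 * (I.storeSurplusDen c s a : ℝ) * (s' 26 0 : ℝ) =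
          max (I.surplus v c G a) 0 * (s' 26 0 * I.storeSurplusDen c s a) by ring,
          mul_lt_mul_iff_left₀ hp, lt_max_iff]
        exact ⟨fun h => h.elim id fun h => absurd h (not_lt.2 h0), Or.inl⟩
    refine Prog.runs_cond (by omega) (fun hne => ?_) fun heq => ?_
    · rw [hcond] at hne
      refine Prog.runs_seq_assign (by omega) 0 (k + 1) rfl (by simp [Expr.val, Expr.reg, hk0])
        (by omega) ?_
      set s₁ := s'.put 24 0 (k + 1) with hs₁
      have g : ∀ y, y ≠ 24 → s₁ y = s' y := fun y hy => s'.put_of_ne _ _ hy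
      have hl₁ : I.Loaded h b s₁ := hs'.congr fun y hy => g y (by omega)
      have e1 : (Expr.surplusNum (Expr.reg 23)).val s₁ = I.storeSurplusNum c s a := by
        rw [val_surplusNum hl₁ (c := c) (a := a) (by rw [g 18 (by decide)]; exact H'.type)
          (by rw [g 23 (by decide)]; exact hk0')]
        rw [← hnum]
        exact storeSurplusNum_congr (g _ (by decide)) (g _ (by decide)) (g _ (by decide))
          (g _ (by decide)) a
      refine Prog.runs_seq_assign (by omega) 0 _ rfl e1
        ((H.surplusNum_lt a).trans_le hpow) ?_
      set s₂ := s₁.put 25 0 (I.storeSurplusNum c s a) with hs₂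
      have g₂ : ∀ y, y ≠ 25 → s₂ y = s₁ y := fun y hy => s₁.put_of_ne _ _ hy
      have hl₂ : I.Loaded h b s₂ := hl₁.congr fun y hy => g₂ y (by omega)
      have e2 : (Expr.surplusDen (Expr.reg 23)).val s₂ = I.storeSurplusDen c s a := by
        rw [val_surplusDen hl₂ (c := c) (a := a)
          (by rw [g₂ 18 (by decide), g 18 (by decide)]; exact H'.type)
          (by rw [g₂ 23 (by decide), g 23 (by decide)]; exact hk0')]
        rw [← hden]
        exact storeSurplusDen_congr (by rw [g₂ _ (by decide), g _ (by decide)])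
          (by rw [g₂ _ (by decide), g _ (by decide)]) a
      refine Prog.runs_assign (by omega) 0 _ rfl e2 ((H.surplusDen_lt a).trans_le hpow) ?_
      rw [bestItem, dif_pos hk, if_pos hne]
      simp only [StoresBest, Option.elim]
      simp [Store.put_of_ne, Store.put_self, hs₂, hs₁, ha]
    · have : ¬ (a ∉ l ∧ (I.bestItem v c G l k).2 < I.surplus v c G a) := fun h2 =>
        hcond.2 h2 heq
      refine Prog.runs_skip ?_
      rw [bestItem, dif_pos hk, if_neg this]
      simpa [StoresBest, Store.put_of_ne] using hinv
  · intro s' _ h'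
    exact h'

end

end Instance

namespace Instance

theorem StoresPrices.mono {I : Instance} {v : Fin I.items → ℝ} {B B' : ℕ} {s : Store}
    (H : I.StoresPrices v B s) (hB : B ≤ B') : I.StoresPrices v B' s := fun a =>
  have hp : 2 ^ B ≤ 2 ^ B' := Nat.pow_le_pow_right two_pos hB
  ⟨(H a).1, (H a).2.1.trans_le hp, (H a).2.2.1.trans_le hp, (H a).2.2.2⟩

/-- Array `15` holds a list in reverse order, and register `21` its length. -/
def StoresList (I : Instance) (l : List (Fin I.items)) (s : Store) : Prop :=
  s 21 0 = l.length ∧ ∀ q (hq : q < l.length), s 15 (l.length - 1 - q) = l[q].val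

/-! ### The computation of greedy lists -/

section
variable {I : Instance} {v : Fin I.items → ℝ} {c : Fin I.types} {G : ℝ}
  {l : List (Fin I.items)} {j B Y : ℕ} {s : Store}

/-- The denominator of the value is multiplied by one probability, one profit and one price
denominator, hence `2 * I.size + B` bits. One more bit pays for the addition in the numerator. -/
theorem runs_insertBest {M L : ℕ} (H : I.Searching v c G l j B Y s)
    (hlist : I.StoresList l s) {a : Fin I.items} (ha : a ∉ l) (hpos : 0 < I.surplus v c G a)
    (h24 : s 24 0 = a + 1) (h25 : s 25 0 = I.storeSurplusNum c s a)
    (h26 : s 26 0 = I.storeSurplusDen c s a) (hnd : l.Nodup) (hL : I.size + 1 ≤ L)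
    (hj : j + 1 < 2 ^ L) (hBY : Y + (2 * I.size + B + 1) ≤ L) :
    Prog.Runs M L Prog.insertBest s fun s' =>
      I.Searching v c (G + I.surplus v c G a) (a :: l) j B (Y + (2 * I.size + B + 1)) s' ∧
        I.StoresList (a :: l) s' := by
  have hA := I.items_le_size c
  have hsize : I.size < 2 ^ L :=
    Nat.lt_two_pow_self.trans_le (Nat.pow_le_pow_right two_pos (by omega))
  have hpow : 2 ^ (Y + (2 * I.size + B + 1)) ≤ 2 ^ L := Nat.pow_le_pow_right two_pos hBY
  have hpow' : 2 ^ (2 * I.size + B + Y) ≤ 2 ^ (Y + (2 * I.size + B + 1)) :=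
    Nat.pow_le_pow_right two_pos (by omega)
  have hlen : l.length ≤ I.items := by simpa using hnd.length_le_card
  have hlen' : l.length < I.items := by
    refine lt_of_le_of_ne hlen fun h => ?_
    have h2 : l.toFinset = Finset.univ := by
      rw [← Finset.card_eq_iff_eq_univ, List.toFinset_card_of_nodup hnd, h, Fintype.card_fin]
    exact ha (by simpa using (h2 ▸ Finset.mem_univ a : a ∈ l.toFinset))
  set D : ℕ := (I.prob a c).den * (I.profit a c).den * s 12 a with hD
  have hDlt : D < 2 ^ (2 * I.size + B) := by
    calc D < 2 ^ I.size * 2 ^ I.size * 2 ^ B :=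
          Nat.mul_lt_mul'' (Nat.mul_lt_mul'' (I.probDen_lt a c) (I.profitDen_lt a c))
            (H.prices a).2.2.1
      _ = _ := by ring
  have hden : s 26 0 = D * s 20 0 := h26
  have hdiv : s 26 0 / s 20 0 = D := by rw [hden, Nat.mul_div_cancel _ H.den_pos]
  have hnum : s 19 0 * D + s 25 0 < 2 ^ (Y + (2 * I.size + B + 1)) := by
    have h1 : s 19 0 * D < 2 ^ Y * 2 ^ (2 * I.size + B) := Nat.mul_lt_mul'' H.num_lt hDlt
    have h2 : s 25 0 < 2 ^ Y * 2 ^ (2 * I.size + B) := by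
      rw [h25, ← pow_add, add_comm Y]; exact H.surplusNum_lt a
    calc _ < 2 ^ Y * 2 ^ (2 * I.size + B) + 2 ^ Y * 2 ^ (2 * I.size + B) := add_lt_add h1 h2
      _ = _ := by ring
  have hdlt : s 26 0 < 2 ^ (Y + (2 * I.size + B + 1)) := by
    rw [h26]; exact (H.surplusDen_lt a).trans_le hpow'
  have ha2 := a.2
  refine Prog.runs_seq_assign (by omega) 0 (s 19 0 * D + s 25 0) rfl
    (by simp [Expr.val, Expr.reg, hdiv]) (hnum.trans_le hpow) ?_
  refine Prog.runs_seq_assign (by omega) 0 (s 26 0) rfl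
    (by simp [Expr.val, Expr.reg, Store.put_of_ne]) (hdlt.trans_le hpow) ?_
  refine Prog.runs_seq_assign (by omega) a (j + 1)
    (by simp [Expr.val, Expr.reg, Store.put_of_ne, h24])
    (by simp [Expr.val, Expr.reg, Store.put_of_ne, H.step]) hj ?_
  refine Prog.runs_seq_assign (by omega) l.length a
    (by simp [Expr.val, Expr.reg, Store.put_of_ne, hlist.1])
    (by simp [Expr.val, Expr.reg, Store.put_of_ne, h24]) (by omega) ?_
  refine Prog.runs_assign (by omega) 0 (l.length + 1) rfl
    (by simp [Expr.val, Expr.reg, Store.put_of_ne, hlist.1]) (by omega) ?_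
  refine ⟨⟨?_, ?_, ?_, ?_, ?_, ?_, ?_, ?_, ?_⟩, ?_, ?_⟩
  · intro d
    simpa [Store.put_of_ne] using H.prices d
  · simpa [Store.put_of_ne] using H.step
  · simpa [Store.put_of_ne] using H.type
  · simpa [Store.put_of_ne, Store.put_self] using hnum
  · simp only [Store.put_of_ne, Store.put_self, ne_eq, Nat.reduceEqDiff,
      not_false_eq_true, h26]
    exact H.surplusDen_pos a
  · simpa [Store.put_of_ne, Store.put_self] using hdlt
  · simp only [Store.put_of_ne, Store.put_self, ne_eq, Nat.reduceEqDiff,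
      not_false_eq_true]
    push_cast
    rw [h25, H.surplusNum_eq a, max_eq_left hpos.le, H.value, hden, ← h26, hden]
    push_cast
    ring
  · intro d
    simp only [Store.put_of_ne, ne_eq, Nat.reduceEqDiff,
      not_false_eq_true]
    by_cases hd : d = a
    · rw [hd, Store.put_self]
    · rw [Store.put_of_ne_index _ _ _ (fun h => hd (Fin.ext h))]
      simpa [Store.put_of_ne] using H.mark_le d
  · intro d
    simp only [Store.put_of_ne, ne_eq, Nat.reduceEqDiff,
      not_false_eq_true]
    by_cases hd : d = a
    · rw [hd, Store.put_self]
      simp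
    · rw [Store.put_of_ne_index _ _ _ (fun h => hd (Fin.ext h))]
      simpa [Store.put_of_ne, hd] using H.mark_eq d
  · simp [Store.put_self]
  · intro q hq
    simp only [Store.put_of_ne, ne_eq, Nat.reduceEqDiff,
      not_false_eq_true, List.length_cons, Nat.add_sub_cancel]
    rcases q with _ | q
    · simp [Store.put_self]
    · have hq' : q < l.length := by simpa using hq
      rw [Store.put_of_ne_index _ _ _ (by omega)]
      have := hlist.2 q hq'
      rw [show l.length - 1 - q = l.length - (q + 1) by omega] at this
      simpa [Store.put_of_ne] using this

/-- The memory after `i` greedy steps. -/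
def GreedyInv (I : Instance) (v : Fin I.items → ℝ) (c : Fin I.types) (j B i : ℕ) (s : Store) :
    Prop :=
  I.Searching v c (I.greedy v c i).1 (I.greedy v c i).2 j B (1 + i * (2 * I.size + B + 1)) s ∧
    I.StoresList (I.greedy v c i).2 s

theorem GreedyInv.congr {i : ℕ} {s' : Store} (H : I.GreedyInv v c j B i s)
    (h11 : s' 11 = s 11) (h12 : s' 12 = s 12) (h13 : s' 13 = s 13) (h15 : s' 15 = s 15)
    (h16 : s' 16 = s 16) (h18 : s' 18 = s 18) (h19 : s' 19 = s 19) (h20 : s' 20 = s 20)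
    (h21 : s' 21 = s 21) : I.GreedyInv v c j B i s' := by
  refine ⟨H.1.congr h11 h12 h13 h16 h18 h19 h20, ?_⟩
  rw [StoresList, h15, h21]
  exact H.2

theorem Searching.mono {Y' : ℕ} (H : I.Searching v c G l j B Y s) (hY : Y ≤ Y') :
    I.Searching v c G l j B Y' s :=
  have hp : 2 ^ Y ≤ 2 ^ Y' := Nat.pow_le_pow_right two_pos hY
  ⟨H.prices, H.step, H.type, H.num_lt.trans_le hp, H.den_pos, H.den_lt.trans_le hp, H.value,
    H.mark_le, H.mark_eq⟩

theorem runs_greedyStep {M L i : ℕ} {h : I.History} {b : Fin I.types} (hs : I.Loaded h b s)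
    (H : I.GreedyInv v c j B i s) (hM : I.size ≤ M) (hL : I.size + 1 ≤ L) (hj : j + 1 < 2 ^ L)
    (hY : 1 + (i + 1) * (2 * I.size + B + 1) ≤ L) :
    Prog.Runs M L Prog.greedyStep s (I.GreedyInv v c j B (i + 1)) := by
  have h2 : 2 ≤ 2 ^ L := by
    calc 2 = 2 ^ 1 := rfl
      _ ≤ _ := Nat.pow_le_pow_right two_pos (by omega)
  rw [Nat.succ_mul] at hY
  refine Prog.runs_seq_assign (by omega) 0 0 rfl rfl (by omega) ?_
  refine Prog.runs_seq_assign (by omega) 0 0 rfl rfl (by omega) ?_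
  refine Prog.runs_seq_assign (by omega) 0 1 rfl rfl (by omega) ?_
  set s₁ := ((s.put 24 0 0).put 25 0 0).put 26 0 1 with hs₁
  have g : ∀ y, y ≠ 24 → y ≠ 25 → y ≠ 26 → s₁ y = s y := fun y h1 h2 h3 => by
    simp [hs₁, Store.put_of_ne, h1, h2, h3]
  have hl₁ : I.Loaded h b s₁ := hs.congr fun y hy => g y (by omega) (by omega) (by omega)
  have H₁ : I.GreedyInv v c j B i s₁ := by
    apply H.congr <;> exact g _ (by decide) (by decide) (by decide)
  refine (runs_findBest hl₁ H₁.1 (by simp [hs₁, Store.put_of_ne, Store.put_self])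
    (by simp [hs₁, Store.put_of_ne, Store.put_self])
    (by simp [hs₁, Store.put_self]) hM hL (by omega)).seq
      fun s₂ _ hfr hbest => ?_
  have hl₂ : I.Loaded h b s₂ := hl₁.congr fun y hy => hfr y (by
    simp [Prog.writes, Prog.findBest, Prog.forLoop]; omega)
  have H₂ : I.GreedyInv v c j B i s₂ := by
    apply H₁.congr <;> exact hfr _ (by decide)
  obtain ⟨b24, b25, b26⟩ := hbest
  obtain ⟨⟨m, hspec⟩, -⟩ := I.greedy_spec v c i
  have hY' : 1 + i * (2 * I.size + B + 1) ≤ 1 + (i + 1) * (2 * I.size + B + 1) :=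
    Nat.add_le_add_left (Nat.mul_le_mul_right _ (Nat.le_succ i)) 1
  have hval : (Expr.mul (Expr.reg 24) (Expr.sub (Expr.cell 2 (Expr.reg 18)) (Expr.reg 21))).val s₂
      = s₂ 24 0 * (I.timeout c - (I.greedy v c i).2.length) := by
    simp [Expr.val, Expr.reg, H₂.1.type, hl₂.timeout, H₂.2.1]
  refine Prog.runs_cond (by omega) (fun hne => ?_) fun heq => ?_
  · rw [hval, mul_ne_zero_iff] at hne
    rcases hb : I.bestItem v c (I.greedy v c i).1 (I.greedy v c i).2 I.items with ⟨_ | a, q⟩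
    · rw [hb] at b24
      exact absurd b24 hne.1
    · obtain ⟨ha, hq, hpos⟩ := I.bestItem_some v c _ _ _ a (by rw [hb])
      rw [hb] at b24 b25 b26 hq
      simp only at hq
      simp only [Option.elim] at b24 b25 b26
      have hg : I.greedy v c (i + 1) = ((I.greedy v c i).1 +
          I.surplus v c (I.greedy v c i).1 a, a :: (I.greedy v c i).2) := by
        rw [greedy, hb]
        simp only
        rw [if_pos (by omega), hq]
      refine (runs_insertBest H₂.1 H₂.2 ha hpos b24 ?_ ?_ hspec.nodup hL hj (by omega)).mono
        fun s' _ _ hs' => ?_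
      · rw [b25]
        exact (storeSurplusNum_congr (hfr _ (by decide)) (hfr _ (by decide))
          (hfr _ (by decide)) (hfr _ (by decide)) a).symm
      · rw [b26]
        exact (storeSurplusDen_congr (hfr _ (by decide)) (hfr _ (by decide)) a).symm
      · rw [GreedyInv, hg, Nat.succ_mul, ← add_assoc 1]
        exact hs'
  · refine Prog.runs_skip ?_
    rw [hval, Nat.mul_eq_zero] at heq
    -- A zero product means that there is no best item or that the timeout is exhausted; `greedy`
    -- does not change in either case.
    have hg : I.greedy v c (i + 1) = I.greedy v c i := by
      rw [greedy]
      rcases hb : I.bestItem v c (I.greedy v c i).1 (I.greedy v c i).2 I.items with ⟨_ | a, q⟩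
      · rfl
      · rw [hb] at b24
        simp only [Option.elim] at b24
        simp only
        rw [if_neg (by omega)]
    rw [GreedyInv, hg]
    exact ⟨H₂.1.mono hY', H₂.2⟩

theorem runs_greedyLoop {M L : ℕ} {h : I.History} {b : Fin I.types} (hs : I.Loaded h b s)
    (H : I.GreedyInv v c j B 0 s) (hM : I.size ≤ M) (hL : I.size + 1 ≤ L) (hj : j + 1 < 2 ^ L)
    (hY : 1 + I.size * (2 * I.size + B + 1) ≤ L) :
    Prog.Runs M L Prog.greedyLoop s fun s' =>
      I.StoresList (I.greedyList v c) s' ∧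
        (∀ a : Fin I.items, s' 13 a ≤ j + 1) := by
  have hA := I.items_le_size c
  have hsize : I.size < 2 ^ L :=
    Nat.lt_two_pow_self.trans_le (Nat.pow_le_pow_right two_pos (by omega))
  refine Prog.runs_forLoop (by omega) (n := I.items) (hA.trans hM) (hA.trans_lt hsize)
    (I.GreedyInv v c j B) (by decide) ?_ ?_ ?_ ?_
  · intro s' hs'
    simp only [Expr.val, hs' 0 (by decide), hs.items]
  · apply H.congr <;> exact Store.put_of_ne _ _ _ (by decide)
  · intro k hk s' hbd hfr hk0 hinv
    have hs' : I.Loaded h b s' := hs.congr fun y hy => hfr y (by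
      simp [Prog.writes, Prog.greedyStep, Prog.findBest, Prog.insertBest, Prog.forLoop]; omega)
    refine (runs_greedyStep hs' hinv hM hL hj ?_).mono fun s'' _ _ h' => ?_
    · have := Nat.mul_le_mul_right (2 * I.size + B + 1) (Nat.succ_le_of_lt (hk.trans_le hA))
      simp only [Nat.succ_eq_add_one] at this
      omega
    · apply h'.congr <;> exact Store.put_of_ne _ _ _ (by decide)
  · intro s' _ h'
    exact ⟨h'.2, h'.1.mark_le⟩

end

end Instance

namespace Instance

/-! ### The computation of prices -/

/-- The number of bits by which one update of a price increases numerators and denominators. -/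
def stepBits (S : ℕ) : ℕ := 3 * S + 2 + S * S

section
variable {I : Instance} {v : Fin I.items → ℝ} {c : Fin I.types} {l : List (Fin I.items)}
  {j B : ℕ} {s : Store}

/-- The memory after the prices of the first `i` items of the current list have been updated. -/
structure PriceInv (I : Instance) (v : Fin I.items → ℝ) (c : Fin I.types)
    (l : List (Fin I.items)) (B i : ℕ) (s : Store) : Prop where
  prices : I.StoresPrices (I.priceUpdate v c (l.take i)) (B + i * stepBits I.size) s
  type : s 18 0 = c
  list : I.StoresList l s
  den_pos : 0 < s 31 0
  -- This bound does not involve `B`: the probability of reaching an item is a product of input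
  -- data. This keeps the growth of the prices additive.
  den_lt : s 31 0 < 2 ^ (1 + i * I.size)
  num_le : s 30 0 ≤ s 31 0
  miss : (s 30 0 : ℝ) = I.missProb c (l.take i) * (s 31 0 : ℝ)

theorem PriceInv.congr {i : ℕ} {s' : Store} (H : I.PriceInv v c l B i s)
    (h11 : s' 11 = s 11) (h12 : s' 12 = s 12) (h15 : s' 15 = s 15) (h18 : s' 18 = s 18)
    (h21 : s' 21 = s 21) (h30 : s' 30 = s 30) (h31 : s' 31 = s 31) :
    I.PriceInv v c l B i s' := by
  constructor
  · intro a; rw [h11, h12]; exact H.prices a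
  · rw [h18]; exact H.type
  · rw [StoresList, h15, h21]; exact H.list
  · rw [h31]; exact H.den_pos
  · rw [h31]; exact H.den_lt
  · rw [h30, h31]; exact H.num_le
  · rw [h30, h31]; exact H.miss

theorem probNum_le_probDen (I : Instance) (a : Fin I.items) (c : Fin I.types) :
    (I.prob a c).num.toNat ≤ (I.prob a c).den := by
  have h : (((I.prob a c).num.toNat : ℕ) : ℝ) ≤ ((I.prob a c).den : ℝ) := by
    rw [I.probNum_cast]
    exact mul_le_of_le_one_left (Nat.cast_nonneg _) (by exact_mod_cast I.prob_le_one a c)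
  exact_mod_cast h

theorem val_nextItem (H : I.StoresList l s) {i : ℕ} (hi : i < l.length) (h22 : s 22 0 = i) :
    (Expr.cell 15 (Expr.sub (Expr.sub (Expr.reg 21) (Expr.const 1)) (Expr.reg 22))).val s =
      l[i].val := by
  simp only [Expr.val, Expr.reg, H.1, h22]
  exact H.2 i hi

/-- With `q / d` the matching probability and `wn / wd` the profit, these are the entries of the
updated price over the denominator `vd * (d * wd)`. The numerator has two terms of at most `V * (K *
S)`, hence the factor 2. -/
theorem update_lt {vn vd q d wn wd V K S X : ℕ} (hvn : vn < V) (hvd : vd < V) (hq : q ≤ K)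
    (hd : d ≤ K) (hwn : wn ≤ S) (hwd : wd ≤ S) (hwd0 : 0 < wd) (hd0 : 0 < d)
    (hX : V * (K * S) * 2 ≤ X) :
    vn * (d * wd) + q * (wn * vd - vn * wd) < X ∧ vd * (d * wd) < X := by
  have hdw : 0 < d * wd := Nat.mul_pos hd0 hwd0
  have hKS : d * wd ≤ K * S := Nat.mul_le_mul hd hwd
  have key : ∀ x < V, x * (d * wd) < V * (K * S) := fun x hx =>
    ((Nat.mul_lt_mul_right hdw).2 hx).trans_le (Nat.mul_le_mul_left _ hKS)
  have h1 := key vn hvn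
  have h2 := key vd hvd
  have h3 : q * (wn * vd - vn * wd) ≤ V * (K * S) :=
    calc q * (wn * vd - vn * wd) ≤ K * (S * V) :=
          Nat.mul_le_mul hq ((Nat.sub_le _ _).trans (Nat.mul_le_mul hwn hvd.le))
      _ = V * (K * S) := by ring
  omega

-- The list has no repetitions, so the item is not among those already processed: its stored price
-- is still `v a`, and the in-place update agrees with `priceUpdate`, which uses the old prices
-- throughout.
set_option maxHeartbeats 1000000 in
theorem runs_priceStep {M L i : ℕ} {h : I.History} {b : Fin I.types} (hs : I.Loaded h b s)
    (hn : 0 < I.rounds) (hnd : l.Nodup) (hcost : ∀ a ∈ l, v a ≤ I.profit a c)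
    (H : I.PriceInv v c l B i s) (hi : i < l.length) (h22 : s 22 0 = i) (hL : I.size + 1 ≤ L)
    (hB : B + (i + 1) * stepBits I.size ≤ L) (hR : 1 + (i + 1) * I.size ≤ L) :
    Prog.Runs M L Prog.priceStep s (I.PriceInv v c l B (i + 1)) := by
  have hA := I.items_le_size c
  have hsize : I.size < 2 ^ L :=
    Nat.lt_two_pow_self.trans_le (Nat.pow_le_pow_right two_pos (by omega))
  set a : Fin I.items := l[i] with ha
  have ha2 := a.2
  have hlen : l.length ≤ I.items := by simpa using hnd.length_le_card
  have htake : l.take (i + 1) = l.take i ++ [a] := by simp [ha]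
  have hmem : a ∉ l.take i := by
    have h1 : (l.take i ++ [a]).Nodup := htake ▸ hnd.sublist (List.take_sublist _ _)
    have h2 := (List.nodup_append.1 h1).2.2
    exact fun h3 => h2 a h3 a (by simp) rfl
  have hva : I.priceUpdate v c (l.take i) a = v a := by
    simp [priceUpdate, I.reachProb_eq_zero c hmem]
  obtain ⟨hdpos, hnlt, hdlt, hv⟩ := H.prices a
  rw [hva] at hv
  have hvw : v a ≤ I.profit a c := hcost a (by simp [ha])
  set vn := s 11 a
  set vd := s 12 a
  set rn := s 30 0 with hrn
  set rd := s 31 0 with hrd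
  set pn := (I.prob a c).num.toNat with hpn
  set pd := (I.prob a c).den with hpd
  set wn := (I.profit a c).num.toNat with hwn
  set wd := (I.profit a c).den with hwd
  set q := I.mult c * rn * pn with hq
  set d := I.rounds * rd * pd with hd
  have hpn' : (pn : ℝ) = I.prob a c * pd := I.probNum_cast a c
  have hwn' : (wn : ℝ) = I.profit a c * wd := I.profitNum_cast a c
  have hpd0 : 0 < pd := (I.prob a c).den_pos
  have hwd0 : 0 < wd := (I.profit a c).den_pos
  have hrd0 : 0 < rd := H.den_pos
  have hd0 : 0 < d := by positivity
  -- The margin is nonnegative, so the truncated subtraction in the program is a true one.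
  have hle : vn * wd ≤ wn * vd := by
    have : ((vn * wd : ℕ) : ℝ) ≤ ((wn * vd : ℕ) : ℝ) := by
      push_cast
      rw [hv, hwn']
      have := mul_le_mul_of_nonneg_right hvw (by positivity : (0 : ℝ) ≤ vd * wd)
      linarith
    exact_mod_cast this
  have hple : pn ≤ pd := I.probNum_le_probDen a c
  -- The new numerator and denominator of the price.
  set vn' := vn * (d * wd) + q * (wn * vd - vn * wd) with hvn'
  set vd' := vd * (d * wd) with hvd'
  obtain ⟨hvn'lt, hvd'lt⟩ : vn' < 2 ^ (B + (i + 1) * stepBits I.size) ∧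
      vd' < 2 ^ (B + (i + 1) * stepBits I.size) := by
    have hq0 : q ≤ 2 ^ I.size * 2 ^ (1 + i * I.size) * 2 ^ I.size :=
      Nat.mul_le_mul (Nat.mul_le_mul (I.mult_lt c).le (H.num_le.trans H.den_lt.le))
        (I.probNum_lt a c).le
    have hd1 : d ≤ 2 ^ I.size * 2 ^ (1 + i * I.size) * 2 ^ I.size :=
      Nat.mul_le_mul (Nat.mul_le_mul I.rounds_lt.le H.den_lt.le) (I.probDen_lt a c).le
    have hexp : 2 ^ (B + i * stepBits I.size) * (2 ^ I.size * 2 ^ (1 + i * I.size) *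
        2 ^ I.size * 2 ^ I.size) * 2 ≤ 2 ^ (B + (i + 1) * stepBits I.size) := by
      rw [← pow_add, ← pow_add, ← pow_add, ← pow_add, ← pow_succ]
      refine Nat.pow_le_pow_right two_pos ?_
      have : i * I.size ≤ I.size * I.size := Nat.mul_le_mul_right _ (by omega)
      rw [Nat.succ_mul]
      simp only [stepBits]
      omega
    exact update_lt hnlt hdlt hq0 hd1 (I.profitNum_lt a c).le (I.profitDen_lt a c).le hwd0 hd0
      hexp
  have hvd'0 : 0 < vd' := Nat.mul_pos hdpos (Nat.mul_pos hd0 hwd0)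
  have hval : (vn' : ℝ) = I.priceUpdate v c (l.take (i + 1)) a * (vd' : ℝ) := by
    have hn' : (I.rounds : ℝ) ≠ 0 := by exact_mod_cast hn.ne'
    rw [hvn', hvd', htake, priceUpdate, I.reachProb_append_singleton,
      I.reachProb_eq_zero c hmem, if_pos rfl, zero_add, Nat.cast_add, Nat.cast_mul q,
      Nat.cast_sub hle, hq, hd]
    push_cast
    rw [hv, hpn', hwn', hrn, H.miss, ← hrd]
    field_simp
  have hother : ∀ a', a' ≠ a → I.priceUpdate v c (l.take (i + 1)) a' =
      I.priceUpdate v c (l.take i) a' := by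
    intro a' ha'
    rw [htake, priceUpdate, priceUpdate, I.reachProb_append_singleton, if_neg ha', add_zero]
  have hpowB : 2 ^ (B + (i + 1) * stepBits I.size) ≤ 2 ^ L := Nat.pow_le_pow_right two_pos hB
  have hpowR : 2 ^ (1 + (i + 1) * I.size) ≤ 2 ^ L := Nat.pow_le_pow_right two_pos hR
  have hrd' : rd * pd < 2 ^ (1 + (i + 1) * I.size) := by
    refine lt_of_lt_of_le (Nat.mul_lt_mul'' H.den_lt (I.probDen_lt a c)) ?_
    rw [← pow_add]
    exact Nat.pow_le_pow_right two_pos (by rw [Nat.succ_mul]; omega)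
  have hrn' : rn * (pd - pn) ≤ rd * pd := Nat.mul_le_mul H.num_le (Nat.sub_le _ _)
  -- The program.
  refine Prog.runs_seq_assign (by omega) 0 a rfl (val_nextItem H.list hi h22) (by omega) ?_
  refine Prog.runs_seq_assign (by omega) a vn' ?_ ?_ (hvn'lt.trans_le hpowB) ?_
  · simp [Expr.val, Expr.reg, Store.put_self]
  · simp only [Expr.val, Expr.reg, Expr.matchDen, Expr.matchNum, Expr.entry, Store.put_self,
      Store.put_of_ne, ne_eq, Nat.reduceEqDiff, not_false_eq_true, H.type, hs.types, hs.rounds,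
      hs.mult, hs.probNum, hs.probDen, hs.profitNum, hs.profitDen]
    rfl
  refine Prog.runs_seq_assign (by omega) a vd' ?_ ?_ (hvd'lt.trans_le hpowB) ?_
  · simp [Expr.val, Expr.reg, Store.put_self, Store.put_of_ne]
  · simp only [Expr.val, Expr.reg, Expr.matchDen, Expr.entry, Store.put_self,
      Store.put_of_ne, ne_eq, Nat.reduceEqDiff, not_false_eq_true, H.type, hs.types, hs.rounds,
      hs.probDen, hs.profitDen]
    rfl
  refine Prog.runs_seq_assign (by omega) 0 (rn * (pd - pn)) rfl ?_
    ((hrn'.trans_lt hrd').trans_le hpowR) ?_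
  · simp only [Expr.val, Expr.reg, Expr.entry, Store.put_self,
      Store.put_of_ne, ne_eq, Nat.reduceEqDiff, not_false_eq_true, H.type, hs.types,
      hs.probNum, hs.probDen]
    rfl
  refine Prog.runs_assign (by omega) 0 (rd * pd) rfl ?_ (hrd'.trans_le hpowR) ?_
  · simp only [Expr.val, Expr.reg, Expr.entry, Store.put_self,
      Store.put_of_ne, ne_eq, Nat.reduceEqDiff, not_false_eq_true, H.type, hs.types, hs.probDen]
    rfl
  constructor
  · intro a'
    simp only [Store.put_of_ne, ne_eq, Nat.reduceEqDiff, not_false_eq_true]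
    by_cases ha' : a' = a
    · rw [ha']
      have h1 : ∀ t : Store, t.put 11 a vn' 11 a = vn' := fun t => t.put_self _ _ _
      have h2 : ∀ t : Store, t.put 12 a vd' 12 a = vd' := fun t => t.put_self _ _ _
      simp only [h2, h1]
      exact ⟨hvd'0, hvn'lt, hvd'lt, hval⟩
    · have hne : a'.val ≠ a.val := fun h => ha' (Fin.ext h)
      rw [hother a' ha', Store.put_of_ne_index _ _ _ hne]
      simp only [Store.put_of_ne, ne_eq, Nat.reduceEqDiff, not_false_eq_true]
      rw [Store.put_of_ne_index _ _ _ hne]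
      simp only [Store.put_of_ne, ne_eq, Nat.reduceEqDiff, not_false_eq_true]
      exact H.prices.mono (Nat.add_le_add_left (Nat.mul_le_mul_right _ (Nat.le_succ i)) B) a'
  · simpa [Store.put_of_ne] using H.type
  · simpa [StoresList, Store.put_of_ne] using H.list
  · rw [Store.put_self]; positivity
  · rw [Store.put_self]; exact hrd'
  · simpa [Store.put_self, Store.put_of_ne] using hrn'
  · simp only [Store.put_of_ne, Store.put_self, ne_eq, Nat.reduceEqDiff, not_false_eq_true]
    rw [htake, I.missProb_append_singleton, Nat.cast_mul, Nat.cast_sub hple, hpn', hrn, H.miss]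
    push_cast
    ring

theorem runs_priceLoop {M L : ℕ} {h : I.History} {b : Fin I.types} (hs : I.Loaded h b s)
    (hn : 0 < I.rounds) (hnd : l.Nodup) (hcost : ∀ a ∈ l, v a ≤ I.profit a c)
    (H : I.PriceInv v c l B 0 s) (hM : I.size ≤ M) (hL : I.size + 1 ≤ L)
    (hB : B + I.size * stepBits I.size ≤ L) (hR : 1 + I.size * I.size ≤ L) :
    Prog.Runs M L Prog.priceLoop s fun s' =>
      I.StoresPrices (I.priceUpdate v c l) (B + I.size * stepBits I.size) s' := by
  have hA := I.items_le_size c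
  have hsize : I.size < 2 ^ L :=
    Nat.lt_two_pow_self.trans_le (Nat.pow_le_pow_right two_pos (by omega))
  have hlen : l.length ≤ I.size := by
    have : l.length ≤ I.items := by simpa using hnd.length_le_card
    omega
  refine Prog.runs_forLoop (by omega) (n := l.length) (by omega) (by omega)
    (I.PriceInv v c l B) (by decide) ?_ ?_ ?_ ?_
  · intro s' hs'
    simp only [Expr.reg, Expr.val, hs' 21 (by decide), H.list.1]
  · apply H.congr <;> exact Store.put_of_ne _ _ _ (by decide)
  · intro k hk s' hbd hfr hk0 hinv
    have hs' : I.Loaded h b s' := hs.congr fun y hy => hfr y (by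
      simp [Prog.writes, Prog.priceStep, Prog.nextItem]; omega)
    have hk' : k + 1 ≤ I.size := by omega
    have h1 := Nat.mul_le_mul_right (stepBits I.size) hk'
    have h2 := Nat.mul_le_mul_right I.size hk'
    refine (runs_priceStep hs' hn hnd hcost hinv hk hk0 hL (by omega) (by omega)).mono
      fun s'' _ _ h' => ?_
    apply h'.congr <;> exact Store.put_of_ne _ _ _ (by decide)
  · intro s' _ h'
    have h3 := h'.prices
    rw [List.take_length] at h3
    exact h3.mono (Nat.add_le_add_left (Nat.mul_le_mul_right _ hlen) B)

/-! ### The main loop -/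

/-- A bound for the number of iterations of the loops. -/
def loopBound {R : Type*} [CommSemiring R] (S : R) : R := S * S + S

/-- A bound for the number of bits of the prices. -/
def priceBits {R : Type*} [CommSemiring R] (S : R) : R := 1 + S * S * (S * (3 * S + 2 + S * S))

/-- A bound for the number of bits of all entries of the memory. -/
def memoryBits {R : Type*} [CommSemiring R] (S : R) : R :=
  1 + S * (2 * S + priceBits S + 1) + priceBits S + S * S + S

/-- The memory after `j` steps of the computation of prices. -/
structure MainInv (I : Instance) (hT : 0 < I.types) (j : ℕ) (s : Store) : Prop where
  prices : I.StoresPrices (I.price j) (1 + j * (I.size * stepBits I.size)) s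
  mark_le : ∀ a : Fin I.items, s 13 a ≤ j
  -- The price update leaves the list alone, so after the last step the list of that step can be
  -- output.
  list : ∀ i, j = i + 1 → I.StoresList (I.greedyList (I.price i) (I.stepType hT i)) s

theorem MainInv.congr {hT : 0 < I.types} {s' : Store} (H : I.MainInv hT j s)
    (h11 : s' 11 = s 11) (h12 : s' 12 = s 12) (h13 : s' 13 = s 13) (h15 : s' 15 = s 15)
    (h21 : s' 21 = s 21) : I.MainInv hT j s' := by
  constructor
  · intro a; rw [h11, h12]; exact H.prices a
  · rw [h13]; exact H.mark_le
  · intro i hi; rw [StoresList, h15, h21]; exact H.list i hi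

/-- Each step adds at most `I.size * stepBits I.size` bits to the prices, and there are at most
`I.size * I.size` steps, so `priceBits` suffices throughout. The greedy values also need many bits,
but they are reset in every step. -/
theorem runs_mainStep {hT : 0 < I.types} {h : I.History} {b : Fin I.types}
    (hs : I.Loaded h b s) (hn : 0 < I.rounds) (H : I.MainInv hT j s) (hj : s 16 0 = j)
    (hjS : j < I.size * I.size) :
    Prog.Runs (loopBound I.size) (memoryBits I.size) Prog.mainStep s (I.MainInv hT (j + 1)) := by
  set S := I.size with hS
  set M := loopBound S with hM
  set L := memoryBits S with hL
  have hMS : S ≤ M := Nat.le_add_left _ _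
  have hLS : S + 1 ≤ L := by simp only [hL, memoryBits]; omega
  have hLS2 : S * S + 1 ≤ L := by simp only [hL, memoryBits]; omega
  have hLp : priceBits S ≤ L := by simp only [hL, memoryBits]; omega
  have hjL : j + 1 < 2 ^ L :=
    lt_of_le_of_lt (by omega : j + 1 ≤ L) Nat.lt_two_pow_self
  have hBp : 1 + (j + 1) * (S * stepBits S) ≤ priceBits S :=
    Nat.add_le_add_left (Nat.mul_le_mul_right _ hjS) 1
  have hB : 1 + j * (S * stepBits S) ≤ priceBits S :=
    (Nat.add_le_add_left (Nat.mul_le_mul_right _ (Nat.le_succ j)) 1).trans hBp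
  have hY : 1 + S * (2 * S + (1 + j * (S * stepBits S)) + 1) ≤ L := by
    have : S * (2 * S + (1 + j * (S * stepBits S)) + 1) ≤ S * (2 * S + priceBits S + 1) :=
      Nat.mul_le_mul_left _ (by omega)
    simp only [hL, memoryBits]
    omega
  set c := I.stepType hT j with hc
  set v := I.price j with hv
  have hcS : c.val < 2 ^ L := by
    have := c.2
    have := I.types_le_size
    have : S < 2 ^ L := lt_of_le_of_lt (by omega : S ≤ L) Nat.lt_two_pow_self
    omega
  have h2 : 2 ≤ 2 ^ L := by
    calc 2 = 2 ^ 1 := rfl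
      _ ≤ _ := Nat.pow_le_pow_right two_pos (by omega)
  have hL1 : 1 ≤ L := by omega
  refine Prog.runs_seq_assign hL1 0 c rfl ?_ hcS ?_
  · simp only [Expr.val, Expr.reg, hj, hs.types, hc, stepType]
    have := Nat.div_add_mod j I.types
    rw [mul_comm] at this
    omega
  refine Prog.runs_seq_assign hL1 0 0 rfl rfl (by omega) ?_
  refine Prog.runs_seq_assign hL1 0 1 rfl rfl (by omega) ?_
  refine Prog.runs_seq_assign hL1 0 0 rfl rfl (by omega) ?_
  set s₁ := (((s.put 18 0 c).put 19 0 0).put 20 0 1).put 21 0 0 with hs₁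
  have g : ∀ y, y ≠ 18 → y ≠ 19 → y ≠ 20 → y ≠ 21 → s₁ y = s y := fun y h1 h2 h3 h4 => by
    simp [hs₁, Store.put_of_ne, h1, h2, h3, h4]
  have hl₁ : I.Loaded h b s₁ :=
    hs.congr fun y hy => g y (by omega) (by omega) (by omega) (by omega)
  have g11 : s₁ 11 = s 11 := g _ (by decide) (by decide) (by decide) (by decide)
  have g12 : s₁ 12 = s 12 := g _ (by decide) (by decide) (by decide) (by decide)
  have g13 : s₁ 13 = s 13 := g _ (by decide) (by decide) (by decide) (by decide)
  have g16 : s₁ 16 = s 16 := g _ (by decide) (by decide) (by decide) (by decide)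
  have g18 : s₁ 18 0 = c := by simp [hs₁, Store.put_of_ne, Store.put_self]
  have hG : I.GreedyInv v c j (1 + j * (S * stepBits S)) 0 s₁ := by
    refine ⟨⟨?_, ?_, g18, ?_, ?_, ?_, ?_, ?_, ?_⟩, ?_, ?_⟩
    · intro a; rw [g11, g12]; exact H.prices a
    · rw [g16]; exact hj
    · simp [hs₁, Store.put_of_ne, Store.put_self]
    · simp [hs₁, Store.put_of_ne, Store.put_self]
    · simp [hs₁, Store.put_of_ne, Store.put_self]
    · simp [hs₁, Store.put_of_ne, Store.put_self, greedy]
    · intro a; rw [g13]; exact (H.mark_le a).trans (Nat.le_succ j)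
    · intro a
      rw [g13]
      have := H.mark_le a
      simp [greedy]
      omega
    · simp [hs₁, Store.put_self, greedy]
    · intro q hq
      simp [greedy] at hq
  refine (runs_greedyLoop hl₁ hG hMS hLS hjL hY).seq fun s₂ _ hfr ⟨hlist, hmark⟩ => ?_
  refine Prog.runs_seq_assign hL1 0 1 rfl rfl (by omega) ?_
  refine Prog.runs_seq_assign hL1 0 1 rfl rfl (by omega) ?_
  set s₃ := (s₂.put 30 0 1).put 31 0 1 with hs₃
  have k : ∀ y, y ≠ 30 → y ≠ 31 → s₃ y = s₂ y := fun y h1 h2 => by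
    simp [hs₃, Store.put_of_ne, h1, h2]
  have hl₃ : I.Loaded h b s₃ := hl₁.congr fun y hy => by
    rw [k y (by omega) (by omega)]
    exact hfr y (by
      simp [Prog.writes, Prog.greedyLoop, Prog.greedyStep, Prog.findBest, Prog.insertBest,
        Prog.forLoop]
      omega)
  have hl3list : I.StoresList (I.greedyList v c) s₃ := by
    rw [StoresList, k 15 (by decide) (by decide), k 21 (by decide) (by decide)]
    exact hlist
  obtain ⟨m, hspec⟩ := I.greedyList_spec v c
  have hP : I.PriceInv v c (I.greedyList v c) (1 + j * (S * stepBits S)) 0 s₃ := by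
    refine ⟨?_, ?_, hl3list, ?_, ?_, ?_, ?_⟩
    · intro a
      rw [k 11 (by decide) (by decide), k 12 (by decide) (by decide), hfr 11 (by decide),
        hfr 12 (by decide), g11, g12]
      simpa [priceUpdate, reachProb] using H.prices a
    · rw [k 18 (by decide) (by decide), hfr 18 (by decide), g18]
    · simp [hs₃, Store.put_self]
    · simp [hs₃, Store.put_self]
    · simp [hs₃, Store.put_self, Store.put_of_ne]
    · simp [hs₃, Store.put_self, Store.put_of_ne, missProb]
  have hB' : 1 + j * (S * stepBits S) + S * stepBits S = 1 + (j + 1) * (S * stepBits S) := by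
    rw [Nat.succ_mul]; omega
  refine (runs_priceLoop hl₃ hn hspec.nodup hspec.cost_le hP hMS hLS
    (hB'.le.trans (hBp.trans hLp)) ((add_comm _ _).trans_le hLS2)).mono fun s₄ _ hfr₄ hprices => ?_
  refine ⟨?_, ?_, ?_⟩
  · rw [price, dif_pos hT, ← hB']
    exact hprices
  · intro a
    rw [hfr₄ 13 (by decide), k 13 (by decide) (by decide)]
    exact hmark a
  · rintro i hi
    obtain rfl : i = j := by omega
    rw [StoresList, hfr₄ 15 (by decide), hfr₄ 21 (by decide)]
    exact hl3list

end

end Instance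

namespace Instance

section
variable {I : Instance} {s : Store} {h : I.History} {b : Fin I.types}

theorem items_lt_two_pow (b : Fin I.types) {L : ℕ} (hL : I.size + 1 ≤ L) :
    I.items + 1 < 2 ^ L := by
  have := I.items_le_size b
  exact lt_of_le_of_lt (by omega) Nat.lt_two_pow_self

/-! ### Initialization and output -/

theorem runs_initPrices {M L : ℕ} (hs : I.Loaded h b s) (hM : I.size ≤ M)
    (hL : I.size + 1 ≤ L) :
    Prog.Runs M L Prog.initPrices s fun s' => ∀ a : Fin I.items, s' 12 a = 1 := by
  have hlt := items_lt_two_pow b hL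
  refine Prog.runs_forLoop (by omega) (n := I.items) ((I.items_le_size b).trans hM) (by omega)
    (fun k s' => ∀ a : Fin I.items, a.val < k → s' 12 a = 1) (by decide) ?_ ?_ ?_ ?_
  · intro s' hs'
    simp only [Expr.val, hs' 0 (by decide), hs.items]
  · intro a ha
    omega
  · intro k hk s' _ _ hk0 hinv
    refine Prog.runs_assign (by omega) k 1 (by simp [Expr.val, Expr.reg, hk0]) rfl (by omega) ?_
    intro a ha
    rw [Store.put_of_ne _ _ _ (by decide)]
    by_cases hak : a.val = k
    · rw [hak, Store.put_self]
    · rw [Store.put_of_ne_index _ _ _ hak]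
      exact hinv a (by omega)
  · intro s' _ h' a
    exact h' a a.2

/-- Marking happens in any order and repeated marks do no harm, so the invariant is availability
with respect to the part of the past already read. -/
theorem runs_markMatched {M L : ℕ} (hs : I.Loaded h b s) (hh : h.length < I.rounds)
    (h14 : ∀ i, s 14 i = 0) (hM : I.size ≤ M) (hL : I.size + 1 ≤ L) :
    Prog.Runs M L Prog.markMatched s fun s' =>
      ∀ a : Fin I.items, s' 14 (a + 1) = 0 ↔ I.Available h a := by
  have hlt := items_lt_two_pow b hL
  have hr := I.rounds_le_size
  have hsize : I.size < 2 ^ L :=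
    Nat.lt_two_pow_self.trans_le (Nat.pow_le_pow_right two_pos (by omega))
  refine Prog.runs_forLoop (by omega) (n := h.length) (by omega) (by omega)
    (fun k s' => ∀ a : Fin I.items, s' 14 (a + 1) = 0 ↔ I.Available (h.take k) a)
    (by decide) ?_ ?_ ?_ ?_
  · intro s' hs'
    simp only [Expr.val, hs' 7 (by decide), hs.length]
  · intro a
    rw [Store.put_of_ne _ _ _ (by decide), h14]
    simp [Available]
  · intro k hk s' _ hfr hk0 hinv
    have hs' : I.Loaded h b s' := hs.congr fun y hy => hfr y (by simp [Prog.writes]; omega)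
    refine Prog.runs_assign (by omega) (h[k].2.elim 0 fun a => a.val + 1) 1
      (by simp only [Expr.val, Expr.reg, hk0]; exact hs'.past k hk) rfl (by omega) ?_
    intro a
    rw [Store.put_of_ne _ _ _ (by decide)]
    have htake : I.Available (h.take (k + 1)) a ↔
        I.Available (h.take k) a ∧ h[k].2 ≠ some a := by
      rw [List.take_succ_eq_append_getElem hk]
      simp only [Available, List.mem_append, List.mem_singleton, or_imp, forall_and,
        forall_eq]
    rw [htake, ← hinv a]
    by_cases hka : h[k].2 = some a
    · simp [hka, Store.put_self]
    · have hne : a.val + 1 ≠ h[k].2.elim 0 fun a => a.val + 1 := by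
        rcases ho : h[k].2 with _ | a'
        · simp
        · simp only [Option.elim]
          intro h1
          exact hka (by rw [ho, Fin.ext (Nat.succ_injective h1)])
      rw [Store.put_of_ne_index _ _ _ hne]
      simp [hka]
  · intro s' _ h'
    rwa [List.take_length] at h'

/-- Array `1` contains a list, and register `32` its length. -/
def StoresOutput (I : Instance) (l : List (Fin I.items)) (s : Store) : Prop :=
  s 32 0 = l.length ∧ ∀ q (hq : q < l.length), s 1 q = l[q].val

theorem runs_outputStep {M L k : ℕ} {l : List (Fin I.items)} (hnd : l.Nodup)
    (hlist : I.StoresList l s) (h14 : ∀ a : Fin I.items, s 14 (a + 1) = 0 ↔ I.Available h a)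
    (hk : k < l.length) (h22 : s 22 0 = k) (b : Fin I.types) (hL : I.size + 1 ≤ L)
    (hout : I.StoresOutput ((l.take k).filter fun a => decide (I.Available h a)) s) :
    Prog.Runs M L Prog.outputStep s
      (I.StoresOutput ((l.take (k + 1)).filter fun a => decide (I.Available h a))) := by
  have hlt := items_lt_two_pow b hL
  have hlen : l.length ≤ I.items := by simpa using hnd.length_le_card
  set a := l[k] with ha
  have ha2 := a.2
  have hfl : ((l.take k).filter fun a => decide (I.Available h a)).length ≤ k :=
    (List.length_filter_le _ _).trans (by simp)
  have htake : (l.take (k + 1)).filter (fun a => decide (I.Available h a)) =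
      (l.take k).filter (fun a => decide (I.Available h a)) ++
        if I.Available h a then [a] else [] := by
    rw [List.take_succ_eq_append_getElem hk, List.filter_append]
    congr 1
    by_cases hav : I.Available h a
    · simp [← ha, hav]
    · simp [← ha, hav]
  rw [htake]
  generalize (l.take k).filter (fun a => decide (I.Available h a)) = f at *
  refine Prog.runs_seq_assign (by omega) 0 a rfl (val_nextItem hlist hk h22) (by omega) ?_
  have hval : (Expr.cell 14 (Expr.add (Expr.reg 27) (Expr.const 1))).val (s.put 27 0 a) =
      s 14 (a + 1) := by
    simp [Expr.val, Expr.reg, Store.put_self, Store.put_of_ne]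
  refine Prog.runs_cond (by omega) (fun hne => ?_) fun heq => ?_
  · rw [hval, ne_eq, h14] at hne
    rw [if_neg hne, List.append_nil]
    exact Prog.runs_skip (by simpa [StoresOutput, Store.put_of_ne] using hout)
  · rw [hval, h14] at heq
    rw [if_pos heq]
    refine Prog.runs_seq_assign (by omega) f.length a
      (by simp [Expr.val, Expr.reg, Store.put_of_ne, hout.1])
      (by simp [Expr.val, Expr.reg, Store.put_self]) (by omega) ?_
    refine Prog.runs_assign (by omega) 0 (f.length + 1) rfl
      (by simp [Expr.val, Expr.reg, Store.put_of_ne, hout.1]) (by omega) ⟨?_, fun q hq => ?_⟩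
    · simp [Store.put_self]
    · rw [Store.put_of_ne _ _ _ (by decide)]
      rcases Nat.lt_or_ge q f.length with hq' | hq'
      · rw [Store.put_of_ne_index _ _ _ hq'.ne, Store.put_of_ne _ _ _ (by decide),
          List.getElem_append_left hq']
        exact hout.2 q hq'
      · obtain rfl : q = f.length := by simp at hq; omega
        rw [Store.put_self]
        simp

theorem runs_outputLoop {M L : ℕ} {l : List (Fin I.items)} (hnd : l.Nodup)
    (hlist : I.StoresList l s) (h14 : ∀ a : Fin I.items, s 14 (a + 1) = 0 ↔ I.Available h a)
    (h32 : s 32 0 = 0) (b : Fin I.types) (hM : I.size ≤ M) (hL : I.size + 1 ≤ L) :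
    Prog.Runs M L Prog.outputLoop s
      (I.StoresOutput (l.filter fun a => decide (I.Available h a))) := by
  have hlt := items_lt_two_pow b hL
  have hlen : l.length ≤ I.items := by simpa using hnd.length_le_card
  have hA := I.items_le_size b
  refine Prog.runs_forLoop (by omega) (n := l.length) (by omega) (by omega)
    (fun k => I.StoresOutput ((l.take k).filter fun a => decide (I.Available h a)))
    (by decide) ?_ ?_ ?_ ?_
  · intro s' hs'
    simp only [Expr.reg, Expr.val, hs' 21 (by decide), hlist.1]
  · simp [StoresOutput, Store.put_of_ne, h32]
  · intro k hk s' _ hfr hk0 hinv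
    have hlist' : I.StoresList l s' := by
      rw [StoresList, hfr 15 (by decide), hfr 21 (by decide)]; exact hlist
    refine (runs_outputStep (h := h) hnd hlist' (by rw [hfr 14 (by decide)]; exact h14) hk hk0 b
      hL hinv).mono fun s'' _ _ h' => ?_
    simpa [StoresOutput, Store.put_of_ne] using h'
  · intro s' _ h'
    rwa [List.take_length] at h'

/-! ### The whole program -/

theorem stepType_mul_add (hT : 0 < I.types) (k : ℕ) (b : Fin I.types) :
    I.stepType hT (k * I.types + b) = b := by
  apply Fin.ext
  simp [stepType, Nat.mul_comm k, Nat.mod_eq_of_lt b.2]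

theorem runs_mainLoop {N : ℕ} (hT : 0 < I.types) (hs : I.Loaded h b s) (hn : 0 < I.rounds)
    (h17 : s 17 0 = N) (hN : N ≤ I.size * I.size) (H : I.MainInv hT 0 s) :
    Prog.Runs (loopBound I.size) (memoryBits I.size) Prog.mainLoop s (I.MainInv hT N) := by
  have hLS : I.size * I.size + 1 ≤ memoryBits I.size := by simp only [memoryBits]; omega
  refine Prog.runs_forLoop (by omega) (n := N) (hN.trans (Nat.le_add_right _ _))
    (lt_of_le_of_lt (by omega) Nat.lt_two_pow_self) (I.MainInv hT) (by decide) ?_ ?_ ?_ ?_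
  · intro s' hs'
    simp only [Expr.reg, Expr.val, hs' 17 (by decide), h17]
  · apply H.congr <;> exact Store.put_of_ne _ _ _ (by decide)
  · intro k hk s' _ hfr hk0 hinv
    have hs' : I.Loaded h b s' := hs.congr fun y hy => hfr y (by
      simp [Prog.writes, Prog.mainStep, Prog.greedyLoop, Prog.greedyStep, Prog.findBest,
        Prog.insertBest, Prog.priceLoop, Prog.priceStep, Prog.nextItem, Prog.forLoop]
      omega)
    refine (runs_mainStep hs' hn hinv hk0 (by omega)).mono fun s'' _ _ h' => ?_
    apply h'.congr <;> exact Store.put_of_ne _ _ _ (by decide)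
  · intro s' _ h'
    exact h'

theorem runs_main (hh : h.length < I.rounds) (hs : I.Loaded h b s)
    (h0 : ∀ x, 11 ≤ x → ∀ i, s x i = 0) :
    Prog.Runs (loopBound I.size) (memoryBits I.size) Prog.main s fun s' =>
      s' 0 0 = (I.pricePolicy h b).length ∧
        ∀ q (hq : q < (I.pricePolicy h b).length), s' 1 q = (I.pricePolicy h b)[q].val := by
  have hM : I.size ≤ loopBound I.size := Nat.le_add_left _ _
  have hLS : I.size + 1 ≤ memoryBits I.size := by simp only [memoryBits]; omega
  have hLS2 : I.size * I.size + 1 ≤ memoryBits I.size := by simp only [memoryBits]; omega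
  have hT : 0 < I.types := b.pos
  set k := I.rounds - 1 - h.length with hk
  -- The list for the current buyer belongs to step `k * I.types + b`, counted from zero; one more
  -- step has to be executed to produce it. The price update of that step is not needed.
  set N := k * I.types + b + 1 with hNdef
  have hN : N ≤ I.size * I.size :=
    calc N ≤ (k + 1) * I.types := by rw [Nat.succ_mul]; have := b.2; omega
      _ ≤ _ := Nat.mul_le_mul (by have := I.rounds_le_size; omega) I.types_le_size
  have hL1 : 1 ≤ memoryBits I.size := by omega
  refine (runs_initPrices hs hM hLS).seq fun s₁ _ f₁ p₁ => ?_
  have hs₁ : I.Loaded h b s₁ := hs.congr fun y hy => f₁ y (by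
    simp [Prog.writes, Prog.initPrices, Prog.forLoop]; omega)
  refine (runs_markMatched hs₁ hh (by rw [f₁ 14 (by decide)]; exact h0 14 (by norm_num)) hM
    hLS).seq fun s₂ _ f₂ p₂ => ?_
  have hs₂ : I.Loaded h b s₂ := hs₁.congr fun y hy => f₂ y (by
    simp [Prog.writes, Prog.markMatched, Prog.forLoop]; omega)
  refine Prog.runs_seq_assign hL1 0 N rfl
    (by simp only [Expr.val, hs₂.rounds, hs₂.length, hs₂.types, hs₂.type, ← hk, hNdef])
    (lt_of_le_of_lt (by omega : N ≤ memoryBits I.size) Nat.lt_two_pow_self) ?_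
  set s₃ := s₂.put 17 0 N with hs₃def
  have f₃ : ∀ y, y ≠ 17 → s₃ y = s₂ y := fun y hy => s₂.put_of_ne _ _ hy
  have hs₃ : I.Loaded h b s₃ := hs₂.congr fun y hy => f₃ y (by omega)
  have H : I.MainInv hT 0 s₃ := by
    refine ⟨fun a => ?_, fun a => ?_, fun i hi => by omega⟩
    · rw [f₃ 11 (by decide), f₃ 12 (by decide), f₂ 11 (by decide), f₂ 12 (by decide),
        f₁ 11 (by decide), h0 11 (by norm_num), p₁ a]
      simp [price]
    · rw [f₃ 13 (by decide), f₂ 13 (by decide), f₁ 13 (by decide), h0 13 (by norm_num)]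
  refine (runs_mainLoop hT hs₃ (by omega) (s₂.put_self _ _ _) hN H).seq fun s₄ _ f₄ p₄ => ?_
  have hlist := p₄.list _ hNdef
  rw [stepType_mul_add hT k b] at hlist
  obtain ⟨m, hspec⟩ := I.greedyList_spec (I.price (k * I.types + b)) b
  refine (runs_outputLoop (h := h) hspec.nodup hlist
    (by rw [f₄ 14 (by decide), f₃ 14 (by decide)]; exact p₂)
    (by rw [f₄ 32 (by decide), f₃ 32 (by decide), f₂ 32 (by decide), f₁ 32 (by decide)]
        exact h0 32 (by norm_num) 0) b hM hLS).seq fun s₅ hbd _ p₅ => ?_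
  refine Prog.runs_assign hL1 0 (s₅ 32 0) rfl rfl (hbd 32 0) ⟨?_, fun q hq => ?_⟩
  · rw [Store.put_self, p₅.1]
    rfl
  · rw [Store.put_of_ne _ _ _ (by decide)]
    exact p₅.2 q hq

end

end Instance

/-! ### The algorithm and its guarantee -/

/-- The algorithm that offers greedy lists with respect to the prices. -/
noncomputable def priceAlgorithm : PolyTimeOnlineAlgorithm where
  program := Prog.main
  coins := 0
  -- The bounds are defined over any commutative semiring, so they can be instantiated at the
  -- indeterminate and yield a polynomial.
  time := Prog.timeBound (Instance.loopBound Polynomial.X) (Instance.memoryBits Polynomial.X)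
    Prog.main
  policy I _ := I.pricePolicy
  feasible I _ := I.pricePolicy_feasible
  computes I r h b hh := by
    have hm : Polynomial.eval I.size (0 : Polynomial ℕ) < 2 ^ Instance.memoryBits I.size := by
      simp
    have hL : I.size + 1 ≤ Instance.memoryBits I.size := by
      simp only [Instance.memoryBits]; omega
    obtain ⟨s, t, h1, h2, -, -, h3, h4⟩ := Instance.runs_main hh (I.loaded_init r h b)
      (fun x hx i => I.init_of_ge r h b hx i) (I.bounded_init r h b hh hm hL)
    refine ⟨s, t, h1, h2.trans (le_of_eq ?_), by simpa using h3, fun i hi => ?_⟩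
    · have := Prog.map_timeBound (Polynomial.evalRingHom I.size)
        (Instance.loopBound Polynomial.X) (Instance.memoryBits Polynomial.X) Prog.main
      rw [Polynomial.coe_evalRingHom] at this
      rw [this]
      simp [Instance.loopBound, Instance.memoryBits, Instance.priceBits]
    · rw [List.getElem_map]
      exact h4 i (by simpa using hi)

theorem priceAlgorithm_expectedProfit (I : Instance) :
    priceAlgorithm.expectedProfit I = I.pricePolicy.expectedProfit := by
  change (∑ _r : Fin (priceAlgorithm.coins.eval I.size) → Bool, I.pricePolicy.expectedProfit) /
    2 ^ (priceAlgorithm.coins.eval I.size) = _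
  rw [Finset.sum_const, Finset.card_univ, Fintype.card_fun, Fintype.card_bool, Fintype.card_fin,
    nsmul_eq_mul, Nat.cast_pow, Nat.cast_ofNat, mul_div_cancel_left₀ _ (by positivity)]

theorem theorem3 :
    ∃ 𝒜 : PolyTimeOnlineAlgorithm, ∀ I : Instance,
      I.lpOnl / 4.07 ≤ 𝒜.expectedProfit I ∧ I.opt / 4.07 ≤ 𝒜.expectedProfit I := by
  refine ⟨priceAlgorithm, fun I => ?_⟩
  rw [priceAlgorithm_expectedProfit]
  have h1 := I.le_expectedProfit_pricePolicy
  have h2 := I.sum_startPrice_nonneg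
  constructor
  -- Passing from the proven factor 3 to 4.07 uses that the total start price is nonnegative.
  · rw [div_le_iff₀ (by norm_num)]
    linarith [I.lpOnl_le]
  · rw [div_le_iff₀ (by norm_num)]
    linarith [I.opt_le]
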